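/- **Definitions.** A binary code of length $n$ is a nonempty subset of $\mathbb{Z}_2^n$; it is a *Hadamard code* if it has $2n$ codewords and minimum Hamming distance $n/2$. Two binary codes $C_1,C_2\subseteq\mathbb{Z}_2^n$ are *equivalent* if $C_2=\{\mathbf a+\pi(\mathbf c):\mathbf c\in C_1\}$ for some $\mathbf a\in\mathbb{Z}_2^n$ and some permutation $\pi$ of the coordinates. For $s\ge 1$ and $u=\sum_{i=0}^{s-1}u_i2^i\in\mathbb{Z}_{2^s}$, $u_i\in\{0,1\}$, Carlet's Gray map is $\phi_s(u)=(u_{s-1},\dots,u_{s-1})+(u_0,\dots,u_{s-2})Y_{s-1}\in\mathbb{Z}_2^{2^{s-1}}$, where the columns of $Y_{s-1}$ are all the vectors of $\mathbb{Z}_2^{s-1}$, ordered as the binary expansions of $0,1,\dots,2^{s-1}-1$. Let $\Phi_s$ be its component-wise extension, and $\Phi(u_1\mid u_2\mid u_3)=(u_1,\Phi_2(u_2),\Phi_3(u_3))$ on $\mathbb{Z}_2^{\alpha_1}\times\mathbb{Z}_4^{\alpha_2}\times\mathbb{Z}_8^{\alpha_3}$, with values in $\mathbb{Z}_2^{\alpha_1+2\alpha_2+4\alpha_3}$.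 A $\mathbb{Z}_2\mathbb{Z}_4\mathbb{Z}_8$-linear (respectively $\mathbb{Z}_2\mathbb{Z}_4$-linear, $\mathbb{Z}_4$-linear) Hadamard code is a Hadamard code of the form $\Phi(\mathcal C)$ (respectively $\Phi(\mathcal C)$, $\Phi_2(\mathcal C)$), where $\mathcal C$ is a subgroup of $\mathbb{Z}_2^{\alpha_1}\times\mathbb{Z}_4^{\alpha_2}\times\mathbb{Z}_8^{\alpha_3}$ (respectively of $\mathbb{Z}_2^{\alpha_1}\times\mathbb{Z}_4^{\alpha_2}$, of $\mathbb{Z}_4^{n}$). For integers $t_1\ge1$, $t_2\ge0$, $t_3\ge1$, the matrices $A^{t_1,t_2,t_3}=(A_1\mid A_2\mid A_3)$ over $\mathbb{Z}_2,\mathbb{Z}_4,\mathbb{Z}_8$ are built from $$A^{1,0,1}=\left(\begin{array}{cc|c|c}1&1&2&4\\0&1&1&1\end{array}\right)$$ by applying, in this order, $t_1-1$ times the construction $$\left(\begin{array}{cc|ccccc|ccccc} A_1 & A_1 &M_1 &A_2 &A_2 &A_2 &A_2 &M_2 &A_3 &A_3 &\cdots &A_3 \\ \mathbf{0} & \mathbf{1}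 & \mathbf{1} &\mathbf{0} &\mathbf{1} &\mathbf{2} &\mathbf{3} &\mathbf{1} &\mathbf{0} &\mathbf{1} &\cdots &\mathbf{7} \end{array}\right),$$ then $t_2$ times the construction $$\left(\begin{array}{cc|ccccc|cccc} A_1 & A_1 &M_1 &A_2 &A_2 &A_2 &A_2 &A_3 &A_3 &A_3 &A_3 \\ \mathbf{0} & \mathbf{1} & \mathbf{1} &\mathbf{0} &\mathbf{1} &\mathbf{2} &\mathbf{3} &\mathbf{0} &\mathbf{2} &\mathbf{4} &\mathbf{6} \end{array}\right),$$ and then $t_3-1$ times the construction $$\left(\begin{array}{cc|cc|cc} A_1 & A_1 & A_2 & A_2 &A_3 &A_3 \\ \mathbf{0} & \mathbf{1} & \mathbf{0} &\mathbf{2} &\mathbf{0} &\mathbf{4} \end{array}\right).$$ Here, if the current matrix $(A_1\mid A_2\mid A_3)$ has $r$ rows, the columns of $M_1$ are all the vectors of $\{2\}\times\{0,2\}^{r-1}$, and those of $M_2$ all the vectors of $\{4\}\times\{0,2,4,6\}^{r-1}$. Let $\mathcal H^{t_1,t_2,t_3}$ be the subgroup generated by the rows of $A^{t_1,t_2,t_3}$,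 and $H^{t_1,t_2,t_3}=\Phi(\mathcal H^{t_1,t_2,t_3})$. **Theorem.** Let $m\ge2$ and $t=3m+2$. The $\mathbb{Z}_2\mathbb{Z}_4\mathbb{Z}_8$-linear code $H^{(t-2)/3,1,1}=H^{m,1,1}$ is a Hadamard code of length $2^t$. It is not equivalent to any code $H^{t_1,t_2,t_3}$ of length $2^t$ with $t_1\ge1$, $t_2\ge0$, $t_3\ge1$ and $(t_1,t_2,t_3)\ne(m,1,1)$, nor to any $\mathbb{Z}_4$-linear Hadamard code of length $2^t$, nor to any $\mathbb{Z}_2\mathbb{Z}_4$-linear Hadamard code of length $2^t$ (for arbitrary $\alpha_1,\alpha_2\ge0$ with $\alpha_1+2\alpha_2=2^t$). -/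

import Mathlib

namespace HadamardCodes

/-- The `i`-th binary digit of `n`, as an element of `ℤ/2`. -/
def bit (n i : ℕ) : ZMod 2 := if n.testBit i then 1 else 0

/-- Carlet's Gray map `φ_s : ℤ/2^s → (ℤ/2)^(2^(s-1))` for `s ≥ 1`:
`φ_s(u) = (u_{s-1}, …, u_{s-1}) + (u_0, …, u_{s-2}) Y_{s-1}`, where the column with index `j` of
`Y_{s-1}` is the vector of binary digits of `j`. -/
def gray (s : ℕ) (u : ZMod (2 ^ s)) (j : Fin (2 ^ (s - 1))) : ZMod 2 :=
  bit u.val (s - 1) + ∑ i ∈ Finset.range (s - 1), bit u.val i * bit j.val i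

/-- The component-wise Gray map `Φ_s` on `(ℤ/2^s)^n`; it has `n * 2^(s-1)` binary coordinates. -/
def grayExt (s : ℕ) {n : ℕ} (u : Fin n → ZMod (2 ^ s)) :
    Fin n × Fin (2 ^ (s - 1)) → ZMod 2 :=
  fun p => gray s (u p.1) p.2

/-- The group `(ℤ/2)^α₁ × (ℤ/4)^α₂ × (ℤ/8)^α₃`. -/
abbrev Mixed (α₁ α₂ α₃ : ℕ) : Type :=
  (Fin α₁ → ZMod 2) × (Fin α₂ → ZMod (2 ^ 2)) × (Fin α₃ → ZMod (2 ^ 3))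

/-- The binary coordinates of the Gray image of `Mixed α₁ α₂ α₃`: there are
`α₁ + 2 * α₂ + 4 * α₃` of them. -/
abbrev Coord (α₁ α₂ α₃ : ℕ) : Type :=
  Fin α₁ ⊕ (Fin α₂ × Fin (2 ^ (2 - 1))) ⊕ (Fin α₃ × Fin (2 ^ (3 - 1)))

/-- The Gray map `Φ(u₁ | u₂ | u₃) = (u₁, Φ₂(u₂), Φ₃(u₃))`. -/
def grayMixed {α₁ α₂ α₃ : ℕ} (u : Mixed α₁ α₂ α₃) : Coord α₁ α₂ α₃ → ZMod 2 :=
  Sum.elim u.1 (Sum.elim (grayExt 2 u.2.1) (grayExt 3 u.2.2))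

/-- Equivalence of binary codes: `D = {a + π(c) : c ∈ C}` for a vector `a` and a bijection `π`
between the coordinates (a coordinate permutation once both sets of coordinates are identified
with `{1, …, n}`). -/
def Equivalent {ι κ : Type*} (C : Set (ι → ZMod 2)) (D : Set (κ → ZMod 2)) : Prop :=
  ∃ (π : ι ≃ κ) (a : κ → ZMod 2), D = (fun c : ι → ZMod 2 => a + c ∘ π.symm) '' C

/-- A binary Hadamard code: if `n` is the length, it has `2 * n` codewords and minimum distance
`n / 2`. -/
def IsHadamard {ι : Type*} [Fintype ι] (C : Set (ι → ZMod 2)) : Prop :=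
  C.ncard = 2 * Fintype.card ι ∧
    ∃ d : ℕ, 2 * d = Fintype.card ι ∧
      IsLeast {e : ℕ | ∃ u ∈ C, ∃ v ∈ C, u ≠ v ∧ hammingDist u v = e} d

/-- A matrix `(A₁ | A₂ | A₃)` with `k + 1` rows and with entries in `ℤ/2`, `ℤ/4` and `ℤ/8`
respectively, given by the lists of the columns of its three blocks. -/
structure GenMatrix where
  k : ℕ
  A₁ : List (Fin (k + 1) → ZMod 2)
  A₂ : List (Fin (k + 1) → ZMod (2 ^ 2))
  A₃ : List (Fin (k + 1) → ZMod (2 ^ 3))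

/-- For `vals = [x₁, …, x_r]`, the columns of the matrix `A A ⋯ A` with the additional last row
`𝐱₁ 𝐱₂ ⋯ 𝐱_r`. -/
def appendRow {R : Type} {k : ℕ} (A : List (Fin k → R)) (vals : List R) :
    List (Fin (k + 1) → R) :=
  vals.flatMap fun x => A.map fun z => (Fin.snoc z x : Fin (k + 1) → R)

/-- The columns `zᵀ` with `z ∈ {h} × S^k`. -/
def blockM {R : Type} (h : R) (S : List R) : (k : ℕ) → List (Fin (k + 1) → R)
  | 0 => [fun _ => h]
  | k + 1 => appendRow (blockM h S k) S

/-- The matrix `A^{1,0,1}`, with rows `(1 1 | 2 | 4)` and `(0 1 | 1 | 1)`. -/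
def baseMatrix : GenMatrix where
  k := 1
  A₁ := [![1, 0], ![1, 1]]
  A₂ := [![2, 1]]
  A₃ := [![4, 1]]

/-- The construction of `A^{ℓ,0,1}` from `A^{ℓ-1,0,1}` (a new row of order `8`). -/
def addRow8 (A : GenMatrix) : GenMatrix where
  k := A.k + 1
  A₁ := appendRow A.A₁ [0, 1]
  A₂ := appendRow (blockM 2 [0, 2] A.k) [1] ++ appendRow A.A₂ [0, 1, 2, 3]
  A₃ := appendRow (blockM 4 [0, 2, 4, 6] A.k) [1] ++ appendRow A.A₃ [0, 1, 2, 3, 4, 5, 6, 7]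

/-- The construction of `A^{t₁,ℓ,1}` from `A^{t₁,ℓ-1,1}` (a new row of order `4`). -/
def addRow4 (A : GenMatrix) : GenMatrix where
  k := A.k + 1
  A₁ := appendRow A.A₁ [0, 1]
  A₂ := appendRow (blockM 2 [0, 2] A.k) [1] ++ appendRow A.A₂ [0, 1, 2, 3]
  A₃ := appendRow A.A₃ [0, 2, 4, 6]

/-- The construction of `A^{t₁,t₂,ℓ}` from `A^{t₁,t₂,ℓ-1}` (a new row of order `2`). -/
def addRow2 (A : GenMatrix) : GenMatrix where
  k := A.k + 1
  A₁ := appendRow A.A₁ [0, 1]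
  A₂ := appendRow A.A₂ [0, 2]
  A₃ := appendRow A.A₃ [0, 4]

/-- The matrix `A^{t₁,t₂,t₃}`, for `t₁ ≥ 1`, `t₂ ≥ 0`, `t₃ ≥ 1`. -/
def genMatrix (t₁ t₂ t₃ : ℕ) : GenMatrix :=
  addRow2^[t₃ - 1] (addRow4^[t₂] (addRow8^[t₁ - 1] baseMatrix))

namespace GenMatrix

/-- The `r`-th row of the matrix. -/
def row (A : GenMatrix) (r : Fin (A.k + 1)) : Mixed A.A₁.length A.A₂.length A.A₃.length :=
  (fun j => A.A₁.get j r, fun j => A.A₂.get j r, fun j => A.A₃.get j r)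

/-- The additive code generated by the rows of the matrix. -/
def additiveCode (A : GenMatrix) :
    AddSubgroup (Mixed A.A₁.length A.A₂.length A.A₃.length) :=
  AddSubgroup.closure (Set.range A.row)

/-- The length `α₁ + 2 * α₂ + 4 * α₃` of the Gray image of the code. -/
def length (A : GenMatrix) : ℕ := A.A₁.length + 2 * A.A₂.length + 4 * A.A₃.length

end GenMatrix

/-- The binary code `H^{t₁,t₂,t₃} = Φ(𝓗^{t₁,t₂,t₃})`. -/
def codeH (t₁ t₂ t₃ : ℕ) :
    Set (Coord (genMatrix t₁ t₂ t₃).A₁.length (genMatrix t₁ t₂ t₃).A₂.length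
      (genMatrix t₁ t₂ t₃).A₃.length → ZMod 2) :=
  grayMixed '' ((genMatrix t₁ t₂ t₃).additiveCode : Set _)

end HadamardCodes

/-!
The invariant that separates the codes is the size of the kernel `K(C) = {x : x + C = C}`, which
equivalence preserves. The Gray map satisfies `Φ(u + v) = Φ(u) + Φ(v)` as soon as `2 • u = 0`, so
for every additive code `𝓒` the kernel of `Φ(𝓒)` contains the Gray image of the `2`-torsion `𝓒[2]`
(`ncard_two_torsion_le_ncard_codeKernel`).

*Lower bounds.* Always `|𝓒| = |𝓒[2]| * |2𝓒|`. If `4𝓒 = 0`, then `2𝓒 ⊆ 𝓒[2]`, so a code with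
`2 ^ (t + 1)` words has a kernel of at least `2 ^ ((t + 1) / 2)` elements. For `H^{t₁,t₂,t₃}` the
group `2𝓒` has at most `4 ^ t₁ * 2 ^ t₂` elements, and the kernel at least `2 ^ (t₁ + t₂ + t₃)`.

*Upper bound.* The kernel of `H^{m,1,1}`, with `m ≥ 2`, is exactly the Gray image of the
`2`-torsion, of size at most `2 ^ (m + 2)` (`codeKernel_codeH_subset`). The coordinates in `ℤ/4`
are characters `χ`, and the failure of additivity of `Φ₂` at `χ` is the product `χ(u) χ(v)` modulo
`2`. Were `Φ(u) + Φ(v)` always a codeword, this product would be linear in `χ`; but if `u` has an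
odd coefficient at some row and `v` is another row, it is not. If all coefficients of `u` are even,
halving `u` and `v` and using the coordinates in `ℤ/8` gives the same contradiction unless `u` has
order at most `2`.

Now `3 * m + 3 = t + 1 = 3 * t₁ + 2 * t₂ + t₃` and `t₁ + t₂ + t₃ ≤ m + 2` force
`(t₁, t₂, t₃) = (m, 1, 1)`, and `(t + 1) / 2 ≤ m + 2` is impossible for `m ≥ 2`.

*The Hadamard property.* Twice the distance between two Gray images is the length minus the
`agreement` of the difference, which adds up, over the coordinates `χ` taken together with their
unit multiples, to a sum of all characters of a product of cyclic groups. The three recursive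
constructions preserve this product formula (`HasCharSums8.addRow8`, `HasCharSums4.addRow4`,
`HasCharSum.addRow2`). It is zero unless every coefficient below the top row is divisible by the
order of its row, so distinct codewords are at distance `n / 2` or `n`; it also yields the length
of the code and the size of the group.
-/

namespace HadamardCodes

open GenMatrix

/-! ### The kernel of a binary code -/

/-- The kernel of a binary code `C`: the vectors whose translation maps `C` into itself. For a
finite code this is the usual `{x : x + C = C}`. -/
def codeKernel {ι : Type*} (C : Set (ι → ZMod 2)) : Set (ι → ZMod 2) :=
  {x | ∀ c ∈ C, x + c ∈ C}

theorem Equivalent.ncard_eq {ι κ : Type*} {C : Set (ι → ZMod 2)} {D : Set (κ → ZMod 2)}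
    (h : Equivalent C D) : D.ncard = C.ncard := by
  obtain ⟨π, a, rfl⟩ := h
  refine Set.ncard_image_of_injective _ fun c d hcd => ?_
  have h := add_left_cancel hcd
  ext i
  simpa using congrFun h (π i)

theorem Equivalent.ncard_codeKernel_eq {ι κ : Type*} {C : Set (ι → ZMod 2)}
    {D : Set (κ → ZMod 2)} (h : Equivalent C D) :
    (codeKernel D).ncard = (codeKernel C).ncard := by
  obtain ⟨π, a, rfl⟩ := h
  have key : codeKernel ((fun c : ι → ZMod 2 => a + c ∘ π.symm) '' C)
      = (fun x : ι → ZMod 2 => x ∘ π.symm) '' codeKernel C := by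
    ext x
    constructor
    · intro hx
      refine ⟨x ∘ π, fun c hc => ?_, by ext; simp⟩
      obtain ⟨d, hd, hdx⟩ := hx _ ⟨c, hc, rfl⟩
      convert hd using 1
      ext i
      have := congrFun hdx (π i)
      simp only [Pi.add_apply, Function.comp_apply, Equiv.symm_apply_apply] at this ⊢
      linear_combination -this
    · rintro ⟨x, hx, rfl⟩ _ ⟨c, hc, rfl⟩
      refine ⟨x + c, hx c hc, ?_⟩
      ext i
      simp only [Pi.add_apply, Function.comp_apply]
      ring
  rw [key]
  refine Set.ncard_image_of_injective _ fun c d hcd => ?_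
  ext i
  simpa using congrFun hcd (π i)

/-- If `Φ` is additive as soon as one argument is killed by `2`, then the `2`-torsion of a group
`C` embeds into the kernel of the code `Φ(C)`. -/
theorem ncard_two_torsion_le_ncard_codeKernel {G ι : Type*} [AddCommGroup G] [Finite ι]
    {Φ : G → ι → ZMod 2} (hinj : Function.Injective Φ)
    (hadd : ∀ u v, (2 : ℕ) • u = 0 → Φ (u + v) = Φ u + Φ v) (C : AddSubgroup G) :
    {u | u ∈ C ∧ (2 : ℕ) • u = 0}.ncard ≤ (codeKernel (Φ '' (C : Set G))).ncard := by
  rw [← Set.ncard_image_of_injective _ hinj]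
  refine Set.ncard_le_ncard ?_ (Set.toFinite _)
  rintro _ ⟨u, ⟨hu, hu2⟩, rfl⟩ _ ⟨v, hv, rfl⟩
  exact ⟨u + v, C.add_mem hu hv, hadd u v hu2⟩

/-! ### Counting in finite abelian groups -/

theorem ncard_eq_two_torsion_mul_double {G : Type*} [AddCommGroup G] (C : AddSubgroup G) :
    (C : Set G).ncard =
      {u | u ∈ C ∧ (2 : ℕ) • u = 0}.ncard * ((fun u : G => (2 : ℕ) • u) '' (C : Set G)).ncard := by
  let f : C →+ G := (nsmulAddMonoidHom 2).comp C.subtype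
  have h := AddSubgroup.card_mul_index f.ker
  rw [AddSubgroup.index_ker] at h
  have h1 : Nat.card f.ker = {u | u ∈ C ∧ (2 : ℕ) • u = 0}.ncard := by
    have himg : {u | u ∈ C ∧ (2 : ℕ) • u = 0} = Subtype.val '' (f.ker : Set C) := by
      ext u
      simp [f, AddMonoidHom.mem_ker, and_comm]
    rw [himg, Set.ncard_image_of_injective _ Subtype.val_injective]
    exact Nat.card_coe_set_eq _
  have h2 : Nat.card f.range = ((fun u : G => (2 : ℕ) • u) '' (C : Set G)).ncard := by
    change Nat.card (f.range : Set G) = _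
    rw [Nat.card_coe_set_eq]
    congr 1
    ext x
    simp [f]
  rw [← h1, ← h2, h]
  exact (Nat.card_coe_set_eq _).symm

theorem ncard_le_sq_two_torsion {G : Type*} [AddCommGroup G] [Finite G] (C : AddSubgroup G)
    (h4 : ∀ u : G, (4 : ℕ) • u = 0) :
    (C : Set G).ncard ≤ {u | u ∈ C ∧ (2 : ℕ) • u = 0}.ncard ^ 2 := by
  rw [ncard_eq_two_torsion_mul_double, sq]
  refine Nat.mul_le_mul_left _ (Set.ncard_le_ncard ?_ (Set.toFinite _))
  rintro _ ⟨u, hu, rfl⟩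
  exact ⟨C.nsmul_mem hu 2, by rw [smul_smul]; exact h4 u⟩

/-- A group generated by elements `f r` with `o r • f r = 0` consists of the combinations of the
`f r` with natural coefficients less than `o r`. -/
theorem closure_range_subset_image_piFinset {G ι : Type*} [AddCommGroup G] [Fintype ι]
    [DecidableEq ι] {f : ι → G} {o : ι → ℕ} (ho : ∀ r, 0 < o r) (hof : ∀ r, o r • f r = 0) :
    (AddSubgroup.closure (Set.range f) : Set G) ⊆
      (fun a : ι → ℕ => ∑ r, a r • f r) '' (Fintype.piFinset fun r => Finset.range (o r)) := by
  intro x hx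
  obtain ⟨c, rfl⟩ := AddSubgroup.mem_closure_range_iff_of_fintype.1 hx
  have hpos : ∀ r, 0 ≤ c r % (o r : ℤ) := fun r => Int.emod_nonneg _ (by have := ho r; omega)
  refine ⟨fun r => (c r % o r).toNat, ?_, ?_⟩
  · simp only [Finset.mem_coe, Fintype.mem_piFinset, Finset.mem_range]
    intro r
    have := Int.emod_lt_of_pos (c r) (b := (o r : ℤ)) (by have := ho r; omega)
    have := hpos r
    omega
  · refine Finset.sum_congr rfl fun r _ => ?_
    rw [← natCast_zsmul, Int.toNat_of_nonneg (hpos r)]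
    conv_rhs => rw [← Int.emod_add_mul_ediv (c r) (o r), add_smul, mul_comm, mul_smul]
    rw [natCast_zsmul, hof, smul_zero, add_zero]

theorem ncard_closure_range_le {G ι : Type*} [AddCommGroup G] [Fintype ι]
    [DecidableEq ι] {f : ι → G} {o : ι → ℕ} (ho : ∀ r, 0 < o r) (hof : ∀ r, o r • f r = 0) :
    (AddSubgroup.closure (Set.range f) : Set G).ncard ≤ ∏ r, o r := by
  refine (Set.ncard_le_ncard (closure_range_subset_image_piFinset ho hof)
    (Set.toFinite _)).trans ((Set.ncard_image_le (Set.toFinite _)).trans ?_)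
  rw [Set.ncard_coe_finset, Fintype.card_piFinset]
  simp

/-! ### The Gray map -/

theorem gray_two_injective : Function.Injective (gray 2) := by
  unfold Function.Injective
  decide +kernel

theorem gray_three_injective : Function.Injective (gray 3) := by
  unfold Function.Injective
  decide +kernel

theorem gray_two_add : ∀ u v : ZMod (2 ^ 2), 2 • u = 0 → gray 2 (u + v) = gray 2 u + gray 2 v := by
  decide +kernel

theorem gray_three_add :
    ∀ u v : ZMod (2 ^ 3), 2 • u = 0 → gray 3 (u + v) = gray 3 u + gray 3 v := by
  decide +kernel

theorem grayExt_two_injective {n : ℕ} :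
    Function.Injective (grayExt 2 : (Fin n → ZMod (2 ^ 2)) → _) := by
  intro u v h
  ext1 j
  exact gray_two_injective (funext fun i => congrFun h (j, i))

theorem grayExt_three_injective {n : ℕ} :
    Function.Injective (grayExt 3 : (Fin n → ZMod (2 ^ 3)) → _) := by
  intro u v h
  ext1 j
  exact gray_three_injective (funext fun i => congrFun h (j, i))

theorem grayExt_two_add {n : ℕ} (u v : Fin n → ZMod (2 ^ 2)) (h : 2 • u = 0) :
    grayExt 2 (u + v) = grayExt 2 u + grayExt 2 v := by
  ext p
  exact congrFun (gray_two_add (u p.1) (v p.1) (congrFun h p.1)) p.2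

theorem grayExt_three_add {n : ℕ} (u v : Fin n → ZMod (2 ^ 3)) (h : 2 • u = 0) :
    grayExt 3 (u + v) = grayExt 3 u + grayExt 3 v := by
  ext p
  exact congrFun (gray_three_add (u p.1) (v p.1) (congrFun h p.1)) p.2

theorem grayMixed_injective {α₁ α₂ α₃ : ℕ} :
    Function.Injective (grayMixed : Mixed α₁ α₂ α₃ → _) := by
  intro u v h
  refine Prod.ext ?_ (Prod.ext ?_ ?_)
  · exact funext fun j => congrFun h (Sum.inl j)
  · exact grayExt_two_injective (funext fun p => congrFun h (Sum.inr (Sum.inl p)))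
  · exact grayExt_three_injective (funext fun p => congrFun h (Sum.inr (Sum.inr p)))

theorem grayMixed_add {α₁ α₂ α₃ : ℕ} (u v : Mixed α₁ α₂ α₃) (h : 2 • u = 0) :
    grayMixed (u + v) = grayMixed u + grayMixed v := by
  ext (j | p | p)
  · rfl
  · exact congrFun (grayExt_two_add u.2.1 v.2.1 (congrArg (fun x => x.2.1) h)) p
  · exact congrFun (grayExt_three_add u.2.2 v.2.2 (congrArg (fun x => x.2.2) h)) p

theorem grayMixed_zero {α₁ α₂ α₃ : ℕ} : grayMixed (0 : Mixed α₁ α₂ α₃) = 0 := by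
  simpa using grayMixed_add (0 : Mixed α₁ α₂ α₃) 0 (by simp)

/-! ### Agreement counts -/

/-- The number of agreements minus the number of disagreements between the (one-bit) Gray images
of `a` and `a + u`. -/
def agreement₁ (u : ZMod 2) : ℤ := if u = 0 then 1 else -1

/-- The number of agreements minus the number of disagreements between the Gray images of `a` and
`a + u`; it does not depend on `a`. -/
def agreement₂ (u : ZMod (2 ^ 2)) : ℤ := if u = 0 then 2 else if u = 2 then -2 else 0

/-- The number of agreements minus the number of disagreements between the Gray images of `a` and
`a + u`; it does not depend on `a`. -/
def agreement₃ (u : ZMod (2 ^ 3)) : ℤ := if u = 0 then 4 else if u = 4 then -4 else 0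

theorem two_mul_sum_ne₁ : ∀ u v : ZMod 2,
    2 * (if u ≠ v then 1 else 0 : ℤ) = 1 - agreement₁ (u - v) := by
  decide +kernel

theorem two_mul_sum_gray_two_ne : ∀ u v : ZMod (2 ^ 2),
    2 * (∑ j, if gray 2 u j ≠ gray 2 v j then 1 else 0 : ℤ) = 2 - agreement₂ (u - v) := by
  decide +kernel

theorem two_mul_sum_gray_three_ne : ∀ u v : ZMod (2 ^ 3),
    2 * (∑ j, if gray 3 u j ≠ gray 3 v j then 1 else 0 : ℤ) = 4 - agreement₃ (u - v) := by
  decide +kernel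

/-- The sum over all coordinates of the agreement counts. -/
def agreement {α₁ α₂ α₃ : ℕ} (u : Mixed α₁ α₂ α₃) : ℤ :=
  ∑ j, agreement₁ (u.1 j) + ∑ j, agreement₂ (u.2.1 j) + ∑ j, agreement₃ (u.2.2 j)

theorem two_mul_hammingDist_grayMixed {α₁ α₂ α₃ : ℕ} (u v : Mixed α₁ α₂ α₃) :
    2 * (hammingDist (grayMixed u) (grayMixed v) : ℤ)
      = (α₁ + 2 * α₂ + 4 * α₃ : ℕ) - agreement (u - v) := by
  have h1 := Finset.sum_congr (rfl : (Finset.univ : Finset (Fin α₁)) = _)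
    fun j _ => two_mul_sum_ne₁ (u.1 j) (v.1 j)
  have h2 := Finset.sum_congr (rfl : (Finset.univ : Finset (Fin α₂)) = _)
    fun j _ => two_mul_sum_gray_two_ne (u.2.1 j) (v.2.1 j)
  have h3 := Finset.sum_congr (rfl : (Finset.univ : Finset (Fin α₃)) = _)
    fun j _ => two_mul_sum_gray_three_ne (u.2.2 j) (v.2.2 j)
  rw [← Finset.mul_sum, Finset.sum_sub_distrib, Finset.sum_const, Finset.card_univ,
    Fintype.card_fin] at h1 h2 h3
  have hd : (hammingDist (grayMixed u) (grayMixed v) : ℤ) =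
      ∑ i, if grayMixed u i ≠ grayMixed v i then 1 else 0 := by
    rw [hammingDist, Finset.card_filter]
    push_cast
    rfl
  rw [hd, Fintype.sum_sum_type, Fintype.sum_sum_type, Fintype.sum_prod_type,
    Fintype.sum_prod_type, mul_add, mul_add]
  refine (congrArg₂ (· + ·) h1 (congrArg₂ (· + ·) h2 h3)).trans ?_
  rw [agreement]
  simp only [Prod.fst_sub, Prod.snd_sub, Pi.sub_apply]
  push_cast
  simp only [nsmul_eq_mul]
  ring

/-- `n` if `n` divides `x`, and `0` otherwise: the sum of the values at `x` of all characters of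
order dividing `n`. -/
def charSum (n : ℕ) (x : ℤ) : ℤ := if (n : ℤ) ∣ x then n else 0

theorem charSum_two_eq (c : ℤ) :
    charSum 2 c = if (c : ZMod 2) = 0 then 2 else 0 := by
  simp only [charSum, ZMod.intCast_zmod_eq_zero_iff_dvd]
  rfl

theorem charSum_two_eq_four (c : ℤ) :
    charSum 2 c = if 2 * (c : ZMod (2 ^ 2)) = 0 then 2 else 0 := by
  have : 2 * (c : ZMod (2 ^ 2)) = 0 ↔ ((2 : ℕ) : ℤ) ∣ c := by
    have h := ZMod.intCast_zmod_eq_zero_iff_dvd (2 * c) (2 ^ 2)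
    push_cast at h ⊢
    rw [h]
    omega
  simp only [charSum, this]
  rfl

theorem charSum_four_eq (c : ℤ) :
    charSum 4 c = if (c : ZMod (2 ^ 2)) = 0 then 4 else 0 := by
  simp only [charSum, ZMod.intCast_zmod_eq_zero_iff_dvd]
  rfl

theorem charSum_two_eq_eight (c : ℤ) :
    charSum 2 c = if 4 * (c : ZMod (2 ^ 3)) = 0 then 2 else 0 := by
  have : 4 * (c : ZMod (2 ^ 3)) = 0 ↔ ((2 : ℕ) : ℤ) ∣ c := by
    have h := ZMod.intCast_zmod_eq_zero_iff_dvd (4 * c) (2 ^ 3)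
    push_cast at h ⊢
    rw [h]
    omega
  simp only [charSum, this]
  rfl

theorem charSum_four_eq_eight (c : ℤ) :
    charSum 4 c = if 2 * (c : ZMod (2 ^ 3)) = 0 then 4 else 0 := by
  have : 2 * (c : ZMod (2 ^ 3)) = 0 ↔ ((4 : ℕ) : ℤ) ∣ c := by
    have h := ZMod.intCast_zmod_eq_zero_iff_dvd (2 * c) (2 ^ 3)
    push_cast at h ⊢
    rw [h]
    omega
  simp only [charSum, this]
  rfl

theorem charSum_eight_eq (c : ℤ) :
    charSum 8 c = if (c : ZMod (2 ^ 3)) = 0 then 8 else 0 := by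
  simp only [charSum, ZMod.intCast_zmod_eq_zero_iff_dvd]
  rfl

theorem agreement₁_cast_eq_four (c : ℤ) :
    agreement₁ c = if 2 * (c : ZMod (2 ^ 2)) = 0 then 1 else -1 := by
  have h := charSum_two_eq_four c
  rw [charSum_two_eq] at h
  unfold agreement₁
  split_ifs at h ⊢ <;> simp_all

theorem agreement₁_cast_eq_eight (c : ℤ) :
    agreement₁ c = if 4 * (c : ZMod (2 ^ 3)) = 0 then 1 else -1 := by
  have h := charSum_two_eq_eight c
  rw [charSum_two_eq] at h
  unfold agreement₁
  split_ifs at h ⊢ <;> simp_all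

theorem sum_agreement₁_all (c : ℤ) (a : ZMod 2) :
    (([0, 1] : List _).map fun x : ZMod 2 => agreement₁ (a + c * x)).sum
      = charSum 2 c * agreement₁ a := by
  rw [charSum_two_eq]
  generalize (c : ZMod 2) = b
  revert a b
  decide +kernel

theorem sum_agreement₂_all (c : ℤ) (a : ZMod (2 ^ 2)) :
    (([0, 1, 2, 3] : List _).map
      fun x : ZMod (2 ^ 2) => agreement₂ (a + (c : ZMod (2 ^ 2)) * x)).sum
      = charSum 4 c * agreement₂ a := by
  rw [charSum_four_eq]
  generalize (c : ZMod (2 ^ 2)) = b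
  revert a b
  decide +kernel

theorem sum_agreement₂_even (c : ℤ) (a : ZMod (2 ^ 2)) :
    (([0, 2] : List _).map
      fun x : ZMod (2 ^ 2) => agreement₂ (a + (c : ZMod (2 ^ 2)) * x)).sum
      = charSum 2 c * agreement₂ a := by
  rw [charSum_two_eq_four]
  generalize (c : ZMod (2 ^ 2)) = b
  revert a b
  decide +kernel

theorem sum_agreement₃_all (c : ℤ) (a : ZMod (2 ^ 3)) :
    (([0, 1, 2, 3, 4, 5, 6, 7] : List _).map
      fun x : ZMod (2 ^ 3) => agreement₃ (a + (c : ZMod (2 ^ 3)) * x)).sum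
      = charSum 8 c * agreement₃ a := by
  rw [charSum_eight_eq]
  generalize (c : ZMod (2 ^ 3)) = b
  revert a b
  decide +kernel

theorem sum_agreement₃_even (c : ℤ) (a : ZMod (2 ^ 3)) :
    (([0, 2, 4, 6] : List _).map
      fun x : ZMod (2 ^ 3) => agreement₃ (a + (c : ZMod (2 ^ 3)) * x)).sum
      = charSum 4 c * agreement₃ a := by
  rw [charSum_four_eq_eight]
  generalize (c : ZMod (2 ^ 3)) = b
  revert a b
  decide +kernel

theorem sum_agreement₃_four (c : ℤ) (a : ZMod (2 ^ 3)) :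
    (([0, 4] : List _).map
      fun x : ZMod (2 ^ 3) => agreement₃ (a + (c : ZMod (2 ^ 3)) * x)).sum
      = charSum 2 c * agreement₃ a := by
  rw [charSum_two_eq_eight]
  generalize (c : ZMod (2 ^ 3)) = b
  revert a b
  decide +kernel

theorem agreement₁_add (c d : ℤ) :
    agreement₁ (c * 1 + d * 0) + agreement₁ (c * 1 + d * 1) = agreement₁ c * charSum 2 d := by
  rw [charSum_two_eq]
  generalize (c : ZMod 2) = a
  generalize (d : ZMod 2) = b
  revert a b
  decide +kernel

theorem agreement₂_two_mul_add (c d : ℤ) :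
    agreement₂ (c * 2 + d * 1) = agreement₁ c * (charSum 4 d - charSum 2 d) := by
  rw [charSum_two_eq_four, charSum_four_eq, agreement₁_cast_eq_four]
  generalize (c : ZMod (2 ^ 2)) = a
  generalize (d : ZMod (2 ^ 2)) = b
  revert a b
  decide +kernel

theorem agreement₃_four_mul_add (c d : ℤ) :
    agreement₃ (c * 4 + d * 1) = agreement₁ c * (charSum 8 d - charSum 4 d) := by
  rw [charSum_four_eq_eight, charSum_eight_eq, agreement₁_cast_eq_eight]
  generalize (c : ZMod (2 ^ 3)) = a
  generalize (d : ZMod (2 ^ 3)) = b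
  revert a b
  decide +kernel

/-! ### Sums over the columns of a matrix -/

/-- The value at a column `z` of the combination of the rows with coefficients `c 0, c 1, …`. -/
def dot {R : Type} [CommRing R] {n : ℕ} (z : Fin n → R) (c : ℕ → ℤ) : R :=
  ∑ r : Fin n, (c r : R) * z r

theorem dot_snoc {R : Type} [CommRing R] {n : ℕ} (z : Fin n → R) (x : R) (c : ℕ → ℤ) :
    dot (Fin.snoc z x : Fin (n + 1) → R) c = dot z c + c n * x := by
  simp [dot, Fin.sum_univ_castSucc]

/-- The sum over the columns `z` of a block `A` of `f (z ⬝ c)`. -/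
def columnSum {R : Type} [CommRing R] {n : ℕ} (f : R → ℤ) (A : List (Fin n → R))
    (c : ℕ → ℤ) : ℤ :=
  (A.map fun z => f (dot z c)).sum

section
variable {R : Type} [CommRing R] {n : ℕ} {f : R → ℤ} {c : ℕ → ℤ} {vals : List R}

theorem columnSum_append (A B : List (Fin n → R)) :
    columnSum f (A ++ B) c = columnSum f A c + columnSum f B c := by
  simp [columnSum]

theorem columnSum_appendRow_eq (A : List (Fin n → R)) :
    columnSum f (appendRow A vals) c
      = (A.map fun z => (vals.map fun x => f (dot z c + c n * x)).sum).sum := by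
  induction vals with
  | nil => simp [columnSum, appendRow]
  | cons x vals ih =>
    have : appendRow A (x :: vals) = A.map (fun z => (Fin.snoc z x : Fin (n + 1) → R)) ++
        appendRow A vals := rfl
    rw [this, columnSum_append, ih]
    simp [columnSum, dot_snoc, Function.comp_def]

theorem columnSum_appendRow {N : ℤ} (A : List (Fin n → R))
    (h : ∀ a, (vals.map fun x => f (a + c n * x)).sum = N * f a) :
    columnSum f (appendRow A vals) c = N * columnSum f A c := by
  rw [columnSum_appendRow_eq]
  simp only [h]
  exact List.sum_map_mul_left ..

theorem columnSum_blockM {g : ℤ → ℤ} (h : R)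
    (hf : ∀ (d : ℤ) (a : R), (vals.map fun x => f (a + d * x)).sum = g d * f a) (k : ℕ) :
    columnSum f (blockM h vals k) c = (∏ i ∈ Finset.range k, g (c (i + 1))) * f (c 0 * h) := by
  induction k with
  | zero => simp [blockM, columnSum, dot]
  | succ k ih =>
    rw [blockM, columnSum_appendRow _ (hf _), ih, Finset.prod_range_succ]
    ring

theorem columnSum_appendRow_blockM {g : ℤ → ℤ} (h x : R)
    (hf : ∀ (d : ℤ) (a : R), (vals.map fun x => f (a + d * x)).sum = g d * f a) (k : ℕ) :
    columnSum f (appendRow (blockM h vals k) [x]) c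
      = (∏ i ∈ Finset.range k, g (c (i + 1))) * f (c 0 * h + c (k + 1) * x) := by
  have := columnSum_blockM (f := fun y => f (y + c (k + 1) * x)) (c := c) h
    (fun d a => by simpa only [add_right_comm] using hf d (a + c (k + 1) * x)) k
  rw [← this, columnSum_appendRow_eq]
  simp [columnSum]

theorem columnSum_blockM_append {g : ℤ → ℤ} {S : List R} {k : ℕ} {N : ℤ} (h : R)
    (hf : ∀ (d : ℤ) (a : R), (S.map fun x => f (a + d * x)).sum = g d * f a)
    (A : List (Fin (k + 1) → R))
    (hA : ∀ a, (vals.map fun x => f (a + c (k + 1) * x)).sum = N * f a) :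
    columnSum f (appendRow (blockM h S k) [1] ++ appendRow A vals) c
      = (∏ i ∈ Finset.range k, g (c (i + 1))) * f (c 0 * h + c (k + 1) * 1)
        + N * columnSum f A c := by
  rw [columnSum_append, columnSum_appendRow_blockM h 1 hf, columnSum_appendRow A hA]

end

namespace GenMatrix

/-- The combination of the rows of `A` with coefficients `c 0, …, c A.k`. -/
def word (A : GenMatrix) (c : ℕ → ℤ) : Mixed A.A₁.length A.A₂.length A.A₃.length :=
  (fun j => dot (A.A₁.get j) c, fun j => dot (A.A₂.get j) c, fun j => dot (A.A₃.get j) c)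

theorem word_eq_sum (A : GenMatrix) (c : ℕ → ℤ) :
    A.word c = ∑ r : Fin (A.k + 1), c r • A.row r := by
  refine Prod.ext ?_ (Prod.ext ?_ ?_) <;> ext j <;>
    simp [word, row, dot, Prod.fst_sum, Prod.snd_sum]

theorem word_zero (A : GenMatrix) : A.word 0 = 0 := by simp [word_eq_sum]

theorem word_add (A : GenMatrix) (c d : ℕ → ℤ) : A.word (c + d) = A.word c + A.word d := by
  simp [word_eq_sum, add_smul, Finset.sum_add_distrib]

theorem word_sub (A : GenMatrix) (c d : ℕ → ℤ) : A.word (c - d) = A.word c - A.word d := by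
  simp [word_eq_sum, sub_smul, Finset.sum_sub_distrib]

theorem mem_additiveCode {A : GenMatrix} {u} : u ∈ A.additiveCode ↔ ∃ c, A.word c = u := by
  rw [additiveCode, AddSubgroup.mem_closure_range_iff_of_fintype]
  constructor
  · rintro ⟨a, rfl⟩
    refine ⟨fun n => if h : n < A.k + 1 then a ⟨n, h⟩ else 0, ?_⟩
    rw [word_eq_sum]
    exact Finset.sum_congr rfl fun r _ => by rw [dif_pos r.2]
  · rintro ⟨c, rfl⟩
    exact ⟨fun r => c r, word_eq_sum A c⟩

theorem agreement_word (A : GenMatrix) (c : ℕ → ℤ) :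
    agreement (A.word c) = columnSum agreement₁ A.A₁ c + columnSum agreement₂ A.A₂ c
      + columnSum agreement₃ A.A₃ c := by
  simp only [agreement, word, columnSum, ← List.sum_ofFn]
  congr 3
  · exact List.ofFn_getElem_eq_map A.A₁ fun z => agreement₁ (dot z c)
  · exact List.ofFn_getElem_eq_map A.A₂ fun z => agreement₂ (dot z c)
  · exact List.ofFn_getElem_eq_map A.A₃ fun z => agreement₃ (dot z c)

end GenMatrix

/-! ### Agreement sums of the generator matrices -/

/-- The product over the rows `1, …, k` of `charSum (o r) (c r)`. -/
def charProd (o : ℕ → ℕ) (k : ℕ) (c : ℕ → ℤ) : ℤ :=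
  ∏ i ∈ Finset.range k, charSum (o (i + 1)) (c (i + 1))

theorem charProd_succ (o : ℕ → ℕ) (k : ℕ) (c : ℕ → ℤ) :
    charProd o (k + 1) c = charProd o k c * charSum (o (k + 1)) (c (k + 1)) :=
  Finset.prod_range_succ ..

/-- The agreement sums of the three blocks are those of a matrix whose columns are, up to units,
all characters of `(ℤ/8)^k`, sorted by their order. -/
structure HasCharSums8 (A : GenMatrix) : Prop where
  sum₁ : ∀ c, columnSum agreement₁ A.A₁ c = agreement₁ (c 0) * charProd (fun _ => 2) A.k c
  sum₂ : ∀ c, columnSum agreement₂ A.A₂ c =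
    agreement₁ (c 0) * (charProd (fun _ => 4) A.k c - charProd (fun _ => 2) A.k c)
  sum₃ : ∀ c, columnSum agreement₃ A.A₃ c =
    agreement₁ (c 0) * (charProd (fun _ => 8) A.k c - charProd (fun _ => 4) A.k c)

theorem hasCharSums8_baseMatrix : HasCharSums8 baseMatrix where
  sum₁ c := by
    change columnSum agreement₁ [![1, 0], ![1, 1]] c = agreement₁ (c 0) * charProd _ 1 c
    simpa [columnSum, dot, charProd] using agreement₁_add (c 0) (c 1)
  sum₂ c := by
    change columnSum agreement₂ [![2, 1]] c =
      agreement₁ (c 0) * (charProd _ 1 c - charProd _ 1 c)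
    simpa [columnSum, dot, charProd] using agreement₂_two_mul_add (c 0) (c 1)
  sum₃ c := by
    change columnSum agreement₃ [![4, 1]] c =
      agreement₁ (c 0) * (charProd _ 1 c - charProd _ 1 c)
    simpa [columnSum, dot, charProd] using agreement₃_four_mul_add (c 0) (c 1)

theorem HasCharSums8.addRow8 {A : GenMatrix} (h : HasCharSums8 A) :
    HasCharSums8 (addRow8 A) where
  sum₁ c := by
    refine (columnSum_appendRow A.A₁ (sum_agreement₁_all _)).trans ?_
    rw [h.sum₁]
    exact (mul_comm _ _).trans ((mul_assoc _ _ _).trans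
      (congrArg _ (charProd_succ _ A.k c).symm))
  sum₂ c := by
    refine (columnSum_blockM_append 2 sum_agreement₂_even A.A₂ (sum_agreement₂_all _)).trans ?_
    refine Eq.trans ?_ (congrArg (agreement₁ (c 0) * ·)
      (congrArg₂ (· - ·) (charProd_succ _ A.k c) (charProd_succ _ A.k c))).symm
    rw [agreement₂_two_mul_add, h.sum₂]
    simp only [charProd]
    ring
  sum₃ c := by
    refine (columnSum_blockM_append 4 sum_agreement₃_even A.A₃ (sum_agreement₃_all _)).trans ?_
    refine Eq.trans ?_ (congrArg (agreement₁ (c 0) * ·)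
      (congrArg₂ (· - ·) (charProd_succ _ A.k c) (charProd_succ _ A.k c))).symm
    rw [agreement₃_four_mul_add, h.sum₃]
    simp only [charProd]
    ring

/-- The agreement sums are those of a matrix whose columns are, up to units, all characters of a
product of cyclic groups of orders `o 1, …, o k`, those of order at most `2` being in the first
block. -/
structure HasCharSums4 (o : ℕ → ℕ) (A : GenMatrix) : Prop where
  sum₁ : ∀ c, columnSum agreement₁ A.A₁ c = agreement₁ (c 0) * charProd (fun _ => 2) A.k c
  sum₂₃ : ∀ c, columnSum agreement₂ A.A₂ c + columnSum agreement₃ A.A₃ c =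
    agreement₁ (c 0) * (charProd o A.k c - charProd (fun _ => 2) A.k c)

theorem HasCharSums8.hasCharSums4 {A : GenMatrix} (h : HasCharSums8 A) {o : ℕ → ℕ}
    (ho : ∀ i < A.k, o (i + 1) = 8) : HasCharSums4 o A where
  sum₁ := h.sum₁
  sum₂₃ c := by
    have : charProd o A.k c = charProd (fun _ => 8) A.k c :=
      Finset.prod_congr rfl fun i hi => by rw [ho i (Finset.mem_range.1 hi)]
    rw [h.sum₂, h.sum₃, this]
    ring

theorem HasCharSums4.addRow4 {A : GenMatrix} {o : ℕ → ℕ} (h : HasCharSums4 o A)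
    (ho : o (A.k + 1) = 4) : HasCharSums4 o (addRow4 A) where
  sum₁ c := by
    refine (columnSum_appendRow A.A₁ (sum_agreement₁_all _)).trans ?_
    rw [h.sum₁]
    exact (mul_comm _ _).trans ((mul_assoc _ _ _).trans
      (congrArg _ (charProd_succ _ A.k c).symm))
  sum₂₃ c := by
    refine (congrArg₂ (· + ·)
      (columnSum_blockM_append 2 sum_agreement₂_even A.A₂ (sum_agreement₂_all _))
      (columnSum_appendRow A.A₃ (sum_agreement₃_even _))).trans ?_
    refine Eq.trans ?_ (congrArg (agreement₁ (c 0) * ·)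
      (congrArg₂ (· - ·) (charProd_succ _ A.k c) (charProd_succ _ A.k c))).symm
    rw [agreement₂_two_mul_add, ho]
    have := h.sum₂₃ c
    simp only [charProd] at this ⊢
    linear_combination charSum 4 (c (A.k + 1)) * this

/-- The agreement of a combination of the rows with the zero word, up to sign, is the sum of the
values of all characters of a product of cyclic groups of orders `o 1, …, o k`. -/
def HasCharSum (o : ℕ → ℕ) (A : GenMatrix) : Prop :=
  ∀ c, agreement (A.word c) = agreement₁ (c 0) * charProd o A.k c

theorem HasCharSums4.hasCharSum {A : GenMatrix} {o : ℕ → ℕ} (h : HasCharSums4 o A) :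
    HasCharSum o A := by
  intro c
  rw [GenMatrix.agreement_word, h.sum₁]
  linear_combination h.sum₂₃ c

theorem HasCharSum.addRow2 {A : GenMatrix} {o : ℕ → ℕ} (h : HasCharSum o A)
    (ho : o (A.k + 1) = 2) : HasCharSum o (addRow2 A) := by
  intro c
  have := h c
  rw [GenMatrix.agreement_word] at this ⊢
  refine (congrArg₂ (· + ·) (congrArg₂ (· + ·)
    (columnSum_appendRow A.A₁ (sum_agreement₁_all _))
    (columnSum_appendRow A.A₂ (sum_agreement₂_even _)))
    (columnSum_appendRow A.A₃ (sum_agreement₃_four _))).trans ?_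
  refine Eq.trans ?_ (congrArg (agreement₁ (c 0) * ·) (charProd_succ o A.k c)).symm
  rw [ho]
  linear_combination charSum 2 (c (A.k + 1)) * this

/-! ### Orders of the rows -/

/-- Every row `r` of a block is killed by `o r`. -/
def RowsKilledBy {R : Type} [CommRing R] {n : ℕ} (o : ℕ → ℕ) (A : List (Fin n → R)) : Prop :=
  ∀ z ∈ A, ∀ r : Fin n, (o r : R) * z r = 0

section
variable {R : Type} [CommRing R] {n : ℕ} {o : ℕ → ℕ} {vals : List R}

theorem RowsKilledBy.append {A B : List (Fin n → R)} (hA : RowsKilledBy o A)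
    (hB : RowsKilledBy o B) : RowsKilledBy o (A ++ B) := fun z hz =>
  (List.mem_append.1 hz).elim (hA z) (hB z)

theorem RowsKilledBy.appendRow {A : List (Fin n → R)} (hA : RowsKilledBy o A)
    (h : ∀ x ∈ vals, (o n : R) * x = 0) : RowsKilledBy o (appendRow A vals) := by
  intro z hz r
  simp only [HadamardCodes.appendRow, List.mem_flatMap, List.mem_map] at hz
  obtain ⟨x, hx, y, hy, rfl⟩ := hz
  induction r using Fin.lastCases with
  | last => simpa using h x hx
  | cast r => simpa using hA y hy r

theorem rowsKilledBy_blockM {h : R} (h0 : (o 0 : R) * h = 0) :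
    ∀ k, (∀ i < k, ∀ x ∈ vals, (o (i + 1) : R) * x = 0) → RowsKilledBy o (blockM h vals k)
  | 0, _ => fun z hz r => by
    obtain rfl : z = fun _ => h := by simpa [blockM] using hz
    obtain rfl : r = 0 := Fin.fin_one_eq_zero r
    exact h0
  | k + 1, hv =>
    (rowsKilledBy_blockM h0 k fun i hi => hv i (by omega)).appendRow (hv k (by omega))

end

namespace GenMatrix

/-- Every row `r` of the matrix is killed by `o r`. -/
def RowOrdersDvd (o : ℕ → ℕ) (A : GenMatrix) : Prop :=
  RowsKilledBy o A.A₁ ∧ RowsKilledBy o A.A₂ ∧ RowsKilledBy o A.A₃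

theorem RowOrdersDvd.nsmul_row {o : ℕ → ℕ} {A : GenMatrix} (h : RowOrdersDvd o A)
    (r : Fin (A.k + 1)) : o r • A.row r = 0 := by
  refine Prod.ext ?_ (Prod.ext ?_ ?_) <;> ext j
  · simpa [row] using h.1 _ (List.get_mem _ j) r
  · simpa [row] using h.2.1 _ (List.get_mem _ j) r
  · simpa [row] using h.2.2 _ (List.get_mem _ j) r

end GenMatrix

theorem rowOrdersDvd_baseMatrix {o : ℕ → ℕ} (h0 : o 0 = 2) (h1 : o 1 = 8) :
    RowOrdersDvd o baseMatrix := by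
  refine ⟨?_, ?_, ?_⟩
  · change RowsKilledBy o [![1, 0], ![1, 1]]
    simp [RowsKilledBy, Fin.forall_fin_two, h0, h1]
    decide
  · change RowsKilledBy o [![2, 1]]
    simp [RowsKilledBy, Fin.forall_fin_two, h0, h1]
    decide
  · change RowsKilledBy o [![4, 1]]
    simp [RowsKilledBy, Fin.forall_fin_two, h0, h1]
    decide

theorem rowOrdersDvd_addRow8 {o : ℕ → ℕ} {A : GenMatrix} (h : RowOrdersDvd o A) (h0 : o 0 = 2)
    (ho : ∀ i ≤ A.k, o (i + 1) = 8) : RowOrdersDvd o (addRow8 A) := by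
  refine ⟨h.1.appendRow ?_,
    ((rowsKilledBy_blockM ?_ _ fun i hi => ?_).appendRow ?_).append (h.2.1.appendRow ?_),
    ((rowsKilledBy_blockM ?_ _ fun i hi => ?_).appendRow ?_).append (h.2.2.appendRow ?_)⟩
  all_goals first | rw [h0] | rw [ho _ le_rfl] | rw [ho i hi.le]
  all_goals decide

theorem rowOrdersDvd_addRow4 {o : ℕ → ℕ} {A : GenMatrix} (h : RowOrdersDvd o A) (h0 : o 0 = 2)
    (ho : ∀ i < A.k, 2 ∣ o (i + 1)) (ho' : o (A.k + 1) = 4) : RowOrdersDvd o (addRow4 A) := by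
  refine ⟨h.1.appendRow ?_,
    ((rowsKilledBy_blockM ?_ _ fun i hi => ?_).appendRow ?_).append (h.2.1.appendRow ?_),
    h.2.2.appendRow ?_⟩
  case refine_3 =>
    obtain ⟨a, ha⟩ := ho i hi
    have : ∀ x ∈ ([0, 2] : List (ZMod (2 ^ 2))), 2 * x = 0 := by decide
    intro x hx
    rw [ha]
    push_cast
    linear_combination (a : ZMod (2 ^ 2)) * this x hx
  all_goals first | rw [h0] | rw [ho']
  all_goals decide

theorem rowOrdersDvd_addRow2 {o : ℕ → ℕ} {A : GenMatrix} (h : RowOrdersDvd o A)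
    (ho : o (A.k + 1) = 2) : RowOrdersDvd o (addRow2 A) := by
  refine ⟨h.1.appendRow ?_, h.2.1.appendRow ?_, h.2.2.appendRow ?_⟩
  all_goals rw [ho]; decide

/-- The orders of the rows of `A^{t₁,t₂,t₃}`. -/
def rowOrder (t₁ t₂ : ℕ) : ℕ → ℕ
  | 0 => 2
  | i + 1 => if i < t₁ then 8 else if i < t₁ + t₂ then 4 else 2

theorem stage8_properties {t₁ t₂ l : ℕ} (hl : l < t₁) :
    (addRow8^[l] baseMatrix).k = l + 1 ∧ HasCharSums8 (addRow8^[l] baseMatrix) ∧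
      RowOrdersDvd (rowOrder t₁ t₂) (addRow8^[l] baseMatrix) := by
  induction l with
  | zero =>
    exact ⟨rfl, hasCharSums8_baseMatrix, rowOrdersDvd_baseMatrix rfl (by simp [rowOrder, hl])⟩
  | succ l ih =>
    obtain ⟨hk, hs, hr⟩ := ih (by omega)
    rw [Function.iterate_succ_apply']
    refine ⟨congrArg (· + 1) hk, hs.addRow8, rowOrdersDvd_addRow8 hr rfl fun i hi => ?_⟩
    simp only [rowOrder]
    rw [if_pos (by omega)]

theorem stage4_properties {t₁ t₂ l : ℕ} (ht₁ : 1 ≤ t₁) (hl : l ≤ t₂) :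
    (addRow4^[l] (addRow8^[t₁ - 1] baseMatrix)).k = t₁ + l ∧
      HasCharSums4 (rowOrder t₁ t₂) (addRow4^[l] (addRow8^[t₁ - 1] baseMatrix)) ∧
      RowOrdersDvd (rowOrder t₁ t₂) (addRow4^[l] (addRow8^[t₁ - 1] baseMatrix)) := by
  induction l with
  | zero =>
    obtain ⟨hk, hs, hr⟩ := stage8_properties (t₂ := t₂) (Nat.sub_lt ht₁ one_pos)
    refine ⟨by rw [Function.iterate_zero_apply]; omega, hs.hasCharSums4 fun i hi => ?_, hr⟩
    simp only [rowOrder]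
    rw [if_pos (by omega)]
  | succ l ih =>
    obtain ⟨hk, hs, hr⟩ := ih (by omega)
    rw [Function.iterate_succ_apply']
    have ho : rowOrder t₁ t₂ ((addRow4^[l] (addRow8^[t₁ - 1] baseMatrix)).k + 1) = 4 := by
      simp only [rowOrder]
      rw [if_neg (by omega), if_pos (by omega)]
    refine ⟨congrArg (· + 1) hk, hs.addRow4 ho, rowOrdersDvd_addRow4 hr rfl (fun i _ => ?_) ho⟩
    simp only [rowOrder]
    split_ifs <;> decide

theorem genMatrix_properties {t₁ t₂ l : ℕ} (ht₁ : 1 ≤ t₁) :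
    (genMatrix t₁ t₂ (l + 1)).k = t₁ + t₂ + l ∧
      HasCharSum (rowOrder t₁ t₂) (genMatrix t₁ t₂ (l + 1)) ∧
      RowOrdersDvd (rowOrder t₁ t₂) (genMatrix t₁ t₂ (l + 1)) := by
  induction l with
  | zero =>
    obtain ⟨hk, hs, hr⟩ := stage4_properties ht₁ (le_refl t₂)
    exact ⟨hk, hs.hasCharSum, hr⟩
  | succ l ih =>
    obtain ⟨hk, hs, hr⟩ := ih
    have hg : genMatrix t₁ t₂ (l + 1 + 1) = addRow2 (genMatrix t₁ t₂ (l + 1)) :=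
      Function.iterate_succ_apply' ..
    have ho : rowOrder t₁ t₂ ((genMatrix t₁ t₂ (l + 1)).k + 1) = 2 := by
      simp only [rowOrder]
      rw [if_neg (by omega), if_neg (by omega)]
    rw [hg]
    exact ⟨congrArg (· + 1) hk, hs.addRow2 ho, rowOrdersDvd_addRow2 hr ho⟩

theorem rowOrder_pos (t₁ t₂ r : ℕ) : 0 < rowOrder t₁ t₂ r := by
  unfold rowOrder
  split
  · decide
  · split_ifs <;> decide

theorem two_dvd_rowOrder (t₁ t₂ r : ℕ) : 2 ∣ rowOrder t₁ t₂ r := by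
  unfold rowOrder
  split
  · decide
  · split_ifs <;> decide

theorem prod_rowOrder (f : ℕ → ℕ) (t₁ t₂ l : ℕ) :
    ∏ i ∈ Finset.range (t₁ + t₂ + l), f (rowOrder t₁ t₂ (i + 1))
      = f 8 ^ t₁ * f 4 ^ t₂ * f 2 ^ l := by
  have h8 : ∀ i ∈ Finset.range t₁, f (rowOrder t₁ t₂ (i + 1)) = f 8 := fun i hi => by
    rw [rowOrder, if_pos (Finset.mem_range.1 hi)]
  have h4 : ∀ i ∈ Finset.range t₂, f (rowOrder t₁ t₂ (t₁ + i + 1)) = f 4 := fun i hi => by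
    rw [rowOrder, if_neg (by omega), if_pos (by have := Finset.mem_range.1 hi; omega)]
  have h2 : ∀ i ∈ Finset.range l, f (rowOrder t₁ t₂ (t₁ + t₂ + i + 1)) = f 2 := fun i hi => by
    rw [rowOrder, if_neg (by omega), if_neg (by omega)]
  rw [Finset.prod_range_add, Finset.prod_range_add, Finset.prod_congr rfl h8,
    Finset.prod_congr rfl h4, Finset.prod_congr rfl h2]
  simp

/-! ### Length, size and distances -/

theorem agreement_zero {α₁ α₂ α₃ : ℕ} :
    agreement (0 : Mixed α₁ α₂ α₃) = (α₁ + 2 * α₂ + 4 * α₃ : ℕ) := by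
  simp [agreement, agreement₁, agreement₂, agreement₃]
  ring

theorem charProd_eq_or (o : ℕ → ℕ) (k : ℕ) (c : ℕ → ℤ) :
    charProd o k c = 0 ∨ ∀ i < k, (o (i + 1) : ℤ) ∣ c (i + 1) := by
  by_cases h : ∀ i < k, (o (i + 1) : ℤ) ∣ c (i + 1)
  · exact Or.inr h
  · push Not at h
    obtain ⟨i, hi, hc⟩ := h
    exact Or.inl (Finset.prod_eq_zero (Finset.mem_range.2 hi) (if_neg hc))

theorem charProd_of_dvd {o : ℕ → ℕ} {k : ℕ} {c : ℕ → ℤ}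
    (h : ∀ i < k, (o (i + 1) : ℤ) ∣ c (i + 1)) :
    charProd o k c = (∏ i ∈ Finset.range k, o (i + 1) : ℕ) := by
  rw [charProd, Nat.cast_prod]
  exact Finset.prod_congr rfl fun i hi => if_pos (h i (Finset.mem_range.1 hi))

theorem HasCharSum.length_eq {o : ℕ → ℕ} {A : GenMatrix} (h : HasCharSum o A) :
    A.length = ∏ i ∈ Finset.range A.k, o (i + 1) := by
  have := h 0
  rw [word_zero, agreement_zero] at this
  rw [charProd_of_dvd (fun i _ => dvd_zero _)] at this
  simp only [Pi.zero_apply, Int.cast_zero, agreement₁, if_true, one_mul, Nat.cast_inj] at this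
  exact this

theorem agreement₁_eq (c : ℤ) : agreement₁ c = if (2 : ℤ) ∣ c then 1 else -1 := by
  simp only [agreement₁, ZMod.intCast_zmod_eq_zero_iff_dvd]
  rfl

/-- Maximal agreement with the zero word forces every coefficient to be divisible by the order of
its row: all the factors of the character sum must be nonzero, and its sign positive. -/
theorem HasCharSum.dvd_of_agreement_eq {o : ℕ → ℕ} {A : GenMatrix} (h : HasCharSum o A)
    (h0 : o 0 = 2) (ho : ∀ r, 0 < o r) {c : ℕ → ℤ} (hc : agreement (A.word c) = A.length) :
    ∀ r < A.k + 1, (o r : ℤ) ∣ c r := by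
  have hpos : (0 : ℤ) < (∏ i ∈ Finset.range A.k, o (i + 1) : ℕ) := by
    exact_mod_cast Finset.prod_pos fun i _ => ho (i + 1)
  rw [h c, h.length_eq, agreement₁_eq] at hc
  rcases charProd_eq_or o A.k c with h1 | h1
  · rw [h1, mul_zero] at hc
    omega
  · rw [charProd_of_dvd h1] at hc
    rintro (_ | r) hr
    · rw [h0, Nat.cast_ofNat]
      by_contra h2
      rw [if_neg h2] at hc
      omega
    · exact h1 r (by omega)

theorem HasCharSum.dvd_of_word_eq_zero {o : ℕ → ℕ} {A : GenMatrix} (h : HasCharSum o A)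
    (h0 : o 0 = 2) (ho : ∀ r, 0 < o r) {c : ℕ → ℤ} (hc : A.word c = 0) :
    ∀ r < A.k + 1, (o r : ℤ) ∣ c r :=
  h.dvd_of_agreement_eq h0 ho (by rw [hc, agreement_zero]; rfl)

theorem GenMatrix.RowOrdersDvd.word_eq_zero {o : ℕ → ℕ} {A : GenMatrix} (h : RowOrdersDvd o A)
    {c : ℕ → ℤ} (hc : ∀ r < A.k + 1, (o r : ℤ) ∣ c r) : A.word c = 0 := by
  rw [word_eq_sum]
  refine Finset.sum_eq_zero fun r _ => ?_
  obtain ⟨d, hd⟩ := hc r r.2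
  rw [hd, mul_comm, mul_smul, natCast_zsmul, h.nsmul_row, smul_zero]

theorem sum_nsmul_row (A : GenMatrix) (a : Fin (A.k + 1) → ℕ) :
    ∑ r, a r • A.row r =
      A.word (fun n => if h : n < A.k + 1 then (a ⟨n, h⟩ : ℤ) else 0) := by
  rw [word_eq_sum]
  refine Finset.sum_congr rfl fun r _ => ?_
  rw [dif_pos r.2, natCast_zsmul]

theorem ncard_additiveCode {o : ℕ → ℕ} {A : GenMatrix} (h : HasCharSum o A)
    (hr : RowOrdersDvd o A) (h0 : o 0 = 2) (ho : ∀ r, 0 < o r) :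
    (SetLike.coe A.additiveCode).ncard = 2 * A.length := by
  have hprod : 2 * A.length = ∏ r : Fin (A.k + 1), o r := by
    rw [h.length_eq, Fin.prod_univ_succ, Fin.val_zero, h0, ← Fin.prod_univ_eq_prod_range]
    rfl
  refine le_antisymm ?_ ?_
  · rw [hprod]
    exact ncard_closure_range_le (fun r => ho r) hr.nsmul_row
  · have hcard : ((Fintype.piFinset fun r : Fin (A.k + 1) => Finset.range (o r) :
        Finset (Fin (A.k + 1) → ℕ)) : Set (Fin (A.k + 1) → ℕ)).ncard = 2 * A.length := by
      rw [Set.ncard_coe_finset, Fintype.card_piFinset, hprod]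
      simp
    rw [← hcard]
    refine Set.ncard_le_ncard_of_injOn (fun a => ∑ r, a r • A.row r) (fun a _ => ?_)
      (fun a ha b hb hab => ?_) (Set.toFinite _)
    · rw [sum_nsmul_row]
      exact mem_additiveCode.2 ⟨_, rfl⟩
    · simp only [sum_nsmul_row] at hab
      rw [← sub_eq_zero, ← word_sub] at hab
      simp only [Finset.mem_coe, Fintype.mem_piFinset, Finset.mem_range] at ha hb
      ext r
      have hd := h.dvd_of_word_eq_zero h0 ho hab r r.2
      simp only [Pi.sub_apply, dif_pos r.2, Fin.eta] at hd
      have h1 := ha r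
      have h2 := hb r
      have := Int.eq_zero_of_abs_lt_dvd hd (by rw [abs_lt]; constructor <;> omega)
      omega

theorem isHadamard_of_hasCharSum {o : ℕ → ℕ} {A : GenMatrix} (h : HasCharSum o A)
    (hr : RowOrdersDvd o A) (h0 : o 0 = 2) (ho : ∀ r, 0 < o r) (hk : 0 < A.k) (h1 : 1 < o 1)
    (heven : 2 ∣ A.length) :
    IsHadamard (grayMixed '' (SetLike.coe A.additiveCode)) := by
  have hcard : Fintype.card (Coord A.A₁.length A.A₂.length A.A₃.length) = A.length := by
    simp [GenMatrix.length]
    ring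
  have hdist : ∀ c d, 2 * (hammingDist (grayMixed (A.word c)) (grayMixed (A.word d)) : ℤ)
      = A.length - agreement (A.word (c - d)) := fun c d => by
    rw [two_mul_hammingDist_grayMixed, word_sub]
    rfl
  obtain ⟨d, hd⟩ := heven
  rw [IsHadamard, hcard, Set.ncard_image_of_injective _ grayMixed_injective,
    ncard_additiveCode h hr h0 ho]
  refine ⟨rfl, d, hd.symm, ?_, ?_⟩
  · have hz : agreement (A.word (Pi.single 1 1 - 0)) = 0 := by
      rw [h]
      rcases charProd_eq_or o A.k (Pi.single 1 1 - 0) with h2 | h2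
      · rw [h2, mul_zero]
      · have := Int.le_of_dvd (by simp) (h2 0 hk)
        simp at this
        omega
    have hdd := hdist (Pi.single 1 1) 0
    rw [hz] at hdd
    have hdd' : hammingDist (grayMixed (A.word (Pi.single 1 1))) (grayMixed (A.word 0)) = d := by
      omega
    refine ⟨_, ⟨_, mem_additiveCode.2 ⟨_, rfl⟩, rfl⟩, _, ⟨_, mem_additiveCode.2 ⟨_, rfl⟩, rfl⟩,
      fun heq => ?_, hdd'⟩
    rw [heq, hammingDist_self] at hdd'
    have : 0 < A.length := by
      rw [h.length_eq]
      exact Finset.prod_pos fun i _ => ho (i + 1)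
    omega
  · rintro e ⟨_, ⟨u, hu, rfl⟩, _, ⟨v, hv, rfl⟩, hne, rfl⟩
    obtain ⟨c, rfl⟩ := mem_additiveCode.1 hu
    obtain ⟨c', rfl⟩ := mem_additiveCode.1 hv
    have hdd := hdist c c'
    have hagr : agreement (A.word (c - c')) ≤ 0 := by
      have hne' : ¬ agreement (A.word (c - c')) = A.length := fun heq => hne <| by
        have := hr.word_eq_zero (h.dvd_of_agreement_eq h0 ho heq)
        rw [word_sub, sub_eq_zero] at this
        rw [this]
      rw [h, h.length_eq] at hne'
      rw [h]
      rcases charProd_eq_or o A.k (c - c') with h2 | h2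
      · rw [h2, mul_zero]
      · rw [charProd_of_dvd h2] at hne' ⊢
        rw [agreement₁_eq] at hne' ⊢
        split_ifs at hne' ⊢ <;> omega
    omega

theorem length_genMatrix {t₁ t₂ t₃ : ℕ} (ht₁ : 1 ≤ t₁) (ht₃ : 1 ≤ t₃) :
    (genMatrix t₁ t₂ t₃).length = 2 ^ (3 * t₁ + 2 * t₂ + t₃ - 1) := by
  obtain ⟨l, rfl⟩ := Nat.exists_eq_add_of_le' ht₃
  obtain ⟨hk, hs, -⟩ := genMatrix_properties (t₂ := t₂) (l := l) ht₁
  rw [hs.length_eq, hk, prod_rowOrder (fun x => x)]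
  rw [show 3 * t₁ + 2 * t₂ + (l + 1) - 1 = 3 * t₁ + 2 * t₂ + l by omega, pow_add, pow_add,
    pow_mul, pow_mul]
  norm_num

theorem isHadamard_codeH {t₁ t₂ t₃ : ℕ} (ht₁ : 1 ≤ t₁) (ht₃ : 1 ≤ t₃) :
    IsHadamard (codeH t₁ t₂ t₃) := by
  have hlen := length_genMatrix (t₂ := t₂) ht₁ ht₃
  obtain ⟨l, rfl⟩ := Nat.exists_eq_add_of_le' ht₃
  obtain ⟨hk, hs, hr⟩ := genMatrix_properties (t₂ := t₂) (l := l) ht₁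
  refine isHadamard_of_hasCharSum hs hr rfl (rowOrder_pos t₁ t₂) (by omega) ?_ ?_
  · rw [rowOrder, if_pos (by omega)]
    decide
  · rw [hlen]
    exact dvd_pow_self 2 (by omega)

theorem ncard_additiveCode_genMatrix {t₁ t₂ t₃ : ℕ} (ht₁ : 1 ≤ t₁) (ht₃ : 1 ≤ t₃) :
    (SetLike.coe (genMatrix t₁ t₂ t₃).additiveCode).ncard = 2 ^ (3 * t₁ + 2 * t₂ + t₃) := by
  have hlen := length_genMatrix (t₂ := t₂) ht₁ ht₃
  obtain ⟨l, rfl⟩ := Nat.exists_eq_add_of_le' ht₃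
  obtain ⟨hk, hs, hr⟩ := genMatrix_properties (t₂ := t₂) (l := l) ht₁
  rw [ncard_additiveCode hs hr rfl (rowOrder_pos t₁ t₂), hlen, ← pow_succ']
  congr 1

/-- The double of the group generated by the rows of `A^{t₁,t₂,t₃}` is generated by elements whose
orders divide `4` (`t₁` times) and `2` (`t₂` times), which bounds the `2`-torsion from below. -/
theorem two_torsion_genMatrix_ge {t₁ t₂ t₃ : ℕ} (ht₁ : 1 ≤ t₁) (ht₃ : 1 ≤ t₃) :
    2 ^ (t₁ + t₂ + t₃) ≤
      {u | u ∈ (genMatrix t₁ t₂ t₃).additiveCode ∧ (2 : ℕ) • u = 0}.ncard := by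
  have hcard := ncard_additiveCode_genMatrix (t₂ := t₂) ht₁ ht₃
  obtain ⟨l, rfl⟩ := Nat.exists_eq_add_of_le' ht₃
  obtain ⟨hk, hs, hr⟩ := genMatrix_properties (t₂ := t₂) (l := l) ht₁
  set A := genMatrix t₁ t₂ (l + 1)
  have hdouble : ((fun u => (2 : ℕ) • u) '' (SetLike.coe A.additiveCode)).ncard ≤
      4 ^ t₁ * 2 ^ t₂ := by
    have himg : (fun u => (2 : ℕ) • u) '' (SetLike.coe A.additiveCode)
        = SetLike.coe (AddSubgroup.closure (Set.range fun r => (2 : ℕ) • A.row r)) := by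
      have := AddMonoidHom.map_closure (nsmulAddMonoidHom 2) (Set.range A.row)
      rw [← Set.range_comp] at this
      exact congrArg SetLike.coe this
    have hhalf (r : ℕ) : rowOrder t₁ t₂ r / 2 * 2 = rowOrder t₁ t₂ r :=
      Nat.div_mul_cancel (two_dvd_rowOrder t₁ t₂ r)
    rw [himg]
    refine (ncard_closure_range_le (o := fun r : Fin (A.k + 1) => rowOrder t₁ t₂ r / 2)
      (fun r => ?_) fun r => ?_).trans_eq ?_
    · have := hhalf r
      have := rowOrder_pos t₁ t₂ r
      omega
    · rw [smul_smul, hhalf]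
      exact hr.nsmul_row r
    · rw [Fin.prod_univ_eq_prod_range (fun r => rowOrder t₁ t₂ r / 2), Finset.prod_range_succ',
        hk, prod_rowOrder (fun x => x / 2)]
      simp [rowOrder]
  rw [ncard_eq_two_torsion_mul_double] at hcard
  have h4 : (4 : ℕ) ^ t₁ * 2 ^ t₂ = 2 ^ (2 * t₁ + t₂) := by
    rw [pow_add, pow_mul]
    norm_num
  rw [h4] at hdouble
  have h2 : 2 ^ (t₁ + t₂ + (l + 1)) * 2 ^ (2 * t₁ + t₂) = 2 ^ (3 * t₁ + 2 * t₂ + (l + 1)) := by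
    rw [← pow_add]
    congr 1
    omega
  rw [← h2] at hcard
  refine Nat.le_of_mul_le_mul_right ?_ (Nat.two_pow_pos (2 * t₁ + t₂))
  rw [← hcard]
  exact Nat.mul_le_mul_left _ hdouble

/-- The `2`-torsion of the group generated by the rows of `A^{t₁,t₂,t₃}` is generated by the rows
multiplied by half of their orders. -/
theorem two_torsion_genMatrix_le {t₁ t₂ t₃ : ℕ} (ht₁ : 1 ≤ t₁) (ht₃ : 1 ≤ t₃) :
    {u | u ∈ (genMatrix t₁ t₂ t₃).additiveCode ∧ (2 : ℕ) • u = 0}.ncard ≤ 2 ^ (t₁ + t₂ + t₃) := by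
  obtain ⟨l, rfl⟩ := Nat.exists_eq_add_of_le' ht₃
  obtain ⟨hk, hs, hr⟩ := genMatrix_properties (t₂ := t₂) (l := l) ht₁
  set A := genMatrix t₁ t₂ (l + 1)
  have hhalf (r : ℕ) : 2 * (rowOrder t₁ t₂ r / 2) = rowOrder t₁ t₂ r :=
    Nat.mul_div_cancel' (two_dvd_rowOrder t₁ t₂ r)
  have hsub : {u | u ∈ A.additiveCode ∧ (2 : ℕ) • u = 0} ⊆
      SetLike.coe (AddSubgroup.closure (Set.range fun r : Fin (A.k + 1) =>
        (rowOrder t₁ t₂ r / 2) • A.row r)) := by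
    rintro _ ⟨hu, h2⟩
    obtain ⟨c, rfl⟩ := mem_additiveCode.1 hu
    rw [two_nsmul, ← word_add] at h2
    have hdvd := hs.dvd_of_word_eq_zero rfl (rowOrder_pos t₁ t₂) h2
    rw [word_eq_sum]
    refine AddSubgroup.sum_mem _ fun r _ => ?_
    obtain ⟨d, hd⟩ := hdvd r r.2
    have hcd : c r = d * (rowOrder t₁ t₂ r / 2 : ℕ) := by
      rw [← hhalf] at hd
      simp only [Pi.add_apply] at hd
      push_cast at hd ⊢
      linarith
    rw [hcd, mul_smul, natCast_zsmul]
    refine AddSubgroup.zsmul_mem _ ?_ d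
    exact AddSubgroup.subset_closure (Set.mem_range_self r)
  refine (Set.ncard_le_ncard hsub (Set.toFinite _)).trans
    ((ncard_closure_range_le (o := fun _ : Fin (A.k + 1) => 2) (fun _ => two_pos)
      fun r => ?_).trans_eq ?_)
  · rw [smul_smul, hhalf]
    exact hr.nsmul_row r
  · simp [hk, add_assoc]

/-! ### Columns of the generator matrices -/

theorem mem_appendRow {R : Type} {n : ℕ} {A : List (Fin n → R)} {vals : List R} {p : ℕ → R}
    (hA : (fun r : Fin n => p r) ∈ A) (hp : p n ∈ vals) :
    (fun r : Fin (n + 1) => p r) ∈ appendRow A vals := by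
  simp only [appendRow, List.mem_flatMap, List.mem_map]
  refine ⟨p n, hp, _, hA, ?_⟩
  ext r
  induction r using Fin.lastCases <;> simp

theorem mem_blockM {R : Type} {h : R} {S : List R} {p : ℕ → R} (h0 : p 0 = h) :
    ∀ k, (∀ i, 1 ≤ i → i ≤ k → p i ∈ S) → (fun r : Fin (k + 1) => p r) ∈ blockM h S k
  | 0, _ => by
    simp only [blockM, List.mem_singleton]
    ext r
    rw [← h0, Fin.fin_one_eq_zero r]
    rfl
  | k + 1, hS => mem_appendRow (mem_blockM h0 k fun i h1 hi => hS i h1 (by omega))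
      (hS (k + 1) (by omega) le_rfl)

/-- The column `p` has top entry `h`, its first entry outside `S` below the top is a `1`, and this
`1` is in one of the rows `1, …, k`. -/
def IsNormalized {R : Type} [One R] (h : R) (S : List R) (k : ℕ) (p : ℕ → R) : Prop :=
  p 0 = h ∧ ∃ j, 1 ≤ j ∧ j ≤ k ∧ p j = 1 ∧ ∀ i, 1 ≤ i → i < j → p i ∈ S

theorem mem_block_append {R : Type} [One R] {h : R} {S vals : List R} {k : ℕ}
    {A : List (Fin (k + 1) → R)} {p : ℕ → R} (hp : IsNormalized h S (k + 1) p)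
    (hvals : p (k + 1) ∈ vals) (hA : IsNormalized h S k p → (fun r : Fin (k + 1) => p r) ∈ A) :
    (fun r : Fin (k + 1 + 1) => p r) ∈
      appendRow (blockM h S k) [1] ++ appendRow A vals := by
  obtain ⟨h0, j, hj, hjk, hpj, hi⟩ := hp
  rw [List.mem_append]
  rcases hjk.eq_or_lt with rfl | hlt
  · exact Or.inl (mem_appendRow (mem_blockM h0 k fun i h1 h2 => hi i h1 (by omega))
      (List.mem_singleton.2 hpj))
  · exact Or.inr (mem_appendRow (hA ⟨h0, j, hj, by omega, hpj, hi⟩) hvals)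

/-- The normalized columns occur in the matrix. -/
structure HasColumns8 (A : GenMatrix) : Prop where
  mem₁ : ∀ p : ℕ → ZMod 2, p 0 = 1 → (fun r : Fin (A.k + 1) => p r) ∈ A.A₁
  mem₂ : ∀ p : ℕ → ZMod (2 ^ 2), IsNormalized 2 [0, 2] A.k p →
    (fun r : Fin (A.k + 1) => p r) ∈ A.A₂
  mem₃ : ∀ p : ℕ → ZMod (2 ^ 3), IsNormalized 4 [0, 2, 4, 6] A.k p →
    (fun r : Fin (A.k + 1) => p r) ∈ A.A₃

theorem hasColumns8_baseMatrix : HasColumns8 baseMatrix where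
  mem₁ p h0 := by
    change (fun r : Fin 2 => p r) ∈ [![1, 0], ![1, 1]]
    have : ∀ x : ZMod 2, x = 0 ∨ x = 1 := by decide
    rcases this (p 1) with h1 | h1
    · have : (fun r : Fin 2 => p r) = ![1, 0] := by ext r; fin_cases r <;> simp [h0, h1]
      simp [this]
    · have : (fun r : Fin 2 => p r) = ![1, 1] := by ext r; fin_cases r <;> simp [h0, h1]
      simp [this]
  mem₂ p hp := by
    change (fun r : Fin 2 => p r) ∈ [![2, 1]]
    obtain ⟨h0, j, hj, hjk, hpj, -⟩ := hp
    obtain rfl : j = 1 := le_antisymm hjk hj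
    have : (fun r : Fin 2 => p r) = ![2, 1] := by ext r; fin_cases r <;> simp [h0, hpj]
    simp [this]
  mem₃ p hp := by
    change (fun r : Fin 2 => p r) ∈ [![4, 1]]
    obtain ⟨h0, j, hj, hjk, hpj, -⟩ := hp
    obtain rfl : j = 1 := le_antisymm hjk hj
    have : (fun r : Fin 2 => p r) = ![4, 1] := by ext r; fin_cases r <;> simp [h0, hpj]
    simp [this]

theorem mem_zmod_two : ∀ x : ZMod 2, x ∈ ([0, 1] : List (ZMod 2)) := by decide

theorem mem_zmod_four : ∀ x : ZMod (2 ^ 2), x ∈ ([0, 1, 2, 3] : List (ZMod (2 ^ 2))) := by decide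

theorem mem_zmod_eight :
    ∀ x : ZMod (2 ^ 3), x ∈ ([0, 1, 2, 3, 4, 5, 6, 7] : List (ZMod (2 ^ 3))) := by decide

theorem hasColumns8_iterate (l : ℕ) : HasColumns8 (addRow8^[l] baseMatrix) := by
  induction l with
  | zero => exact hasColumns8_baseMatrix
  | succ l ih =>
    rw [Function.iterate_succ_apply']
    exact ⟨fun p h0 => mem_appendRow (ih.mem₁ p h0) (mem_zmod_two _),
      fun p hp => mem_block_append hp (mem_zmod_four _) (ih.mem₂ p),
      fun p hp => mem_block_append hp (mem_zmod_eight _) (ih.mem₃ p)⟩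

/-- The columns of `A^{m,1,1}` used to bound the kernel. -/
theorem genMatrix_one_one_columns {m : ℕ} (hm : 1 ≤ m) :
    (∀ p : ℕ → ZMod 2, p 0 = 1 →
      (fun r : Fin ((genMatrix m 1 1).k + 1) => p r) ∈ (genMatrix m 1 1).A₁) ∧
    (∀ p : ℕ → ZMod (2 ^ 2), IsNormalized 2 [0, 2] (m + 1) p →
      (fun r : Fin ((genMatrix m 1 1).k + 1) => p r) ∈ (genMatrix m 1 1).A₂) ∧
    ∀ p : ℕ → ZMod (2 ^ 3), IsNormalized 4 [0, 2, 4, 6] m p → p (m + 1) = 0 →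
      (fun r : Fin ((genMatrix m 1 1).k + 1) => p r) ∈ (genMatrix m 1 1).A₃ := by
  have h := hasColumns8_iterate (m - 1)
  have hk := (stage8_properties (t₂ := 0) (Nat.sub_lt hm one_pos)).1
  have hg : genMatrix m 1 1 = addRow4 (addRow8^[m - 1] baseMatrix) := rfl
  generalize addRow8^[m - 1] baseMatrix = A at h hk hg
  obtain rfl : m = A.k := by omega
  rw [hg]
  refine ⟨fun p h0 => mem_appendRow (h.mem₁ p h0) (mem_zmod_two _),
    fun p hp => mem_block_append hp (mem_zmod_four _) (h.mem₂ p),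
    fun p hp h0 => mem_appendRow (h.mem₃ p hp) ?_⟩
  rw [h0]
  decide

/-- The column with top entry `h`, entries `1` in the rows `i` and `j`, and `0` elsewhere. -/
def pairColumn {R : Type} [CommRing R] (h : R) (i j : ℕ) : ℕ → R :=
  fun r => if r = 0 then h else if r = i ∨ r = j then 1 else 0

theorem isNormalized_pairColumn {R : Type} [CommRing R] {h : R} {S : List R} {k i j : ℕ}
    (hS : 0 ∈ S) (hi : 1 ≤ i) (hj : 1 ≤ j) (hik : i ≤ k) :
    IsNormalized h S k (pairColumn h i j) := by
  refine ⟨if_pos rfl, min i j, le_min hi hj, (min_le_left _ _).trans hik, ?_, fun r h1 h2 => ?_⟩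
  · rw [pairColumn, if_neg (by omega), if_pos (by omega)]
  · rw [pairColumn, if_neg (by omega), if_neg (by omega)]
    exact hS

theorem dot_pairColumn {R : Type} [CommRing R] (h : R) {k i j : ℕ} (hi : 1 ≤ i) (hj : 1 ≤ j)
    (hik : i ≤ k) (hjk : j ≤ k) (c : ℕ → ℤ) :
    dot (fun r : Fin (k + 1) => pairColumn h i j r) c
      = c 0 * h + c i + if i = j then 0 else (c j : R) := by
  have hterm : ∀ r, (c r : R) * pairColumn h i j r = (if r = 0 then c 0 * h else 0)
      + (if r = i then (c i : R) else 0)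
      + if r = j then (if i = j then 0 else (c j : R)) else 0 := by
    intro r
    unfold pairColumn
    split_ifs <;> first | omega | (subst_vars; simp_all)
  rw [dot, Fin.sum_univ_eq_sum_range (fun r => (c r : R) * pairColumn h i j r)]
  simp only [hterm, Finset.sum_add_distrib, Finset.sum_ite_eq', Finset.mem_range]
  rw [if_pos (by omega), if_pos (by omega), if_pos (by omega)]

/-! ### The kernel of the code with one row of order four -/

/-- In `ℤ/4`, the correction `w - y` that makes the Gray map additive at `(y, 1)` does not do so at
`(x + y, 1)` if `x` is odd: the carry changes. The shift `a` is `0` or `2`. -/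
theorem gray_two_not_additive : ∀ a x y w : ZMod (2 ^ 2), 2 * a = 0 → 2 * x ≠ 0 →
    gray 2 (a + w) = gray 2 (a + y) + gray 2 1 →
    gray 2 (a + x + w) ≠ gray 2 (a + x + y) + gray 2 1 := by
  decide +kernel

/-- In `ℤ/8`, the correction `w - y` that makes the Gray map additive at `(y, 2)`, for even `y`,
does not do so at `(x + y, 2)` if `x` has order `4`: the carry changes. The shift `a` is `0` or
`4`. -/
theorem gray_three_not_additive : ∀ a x y w : ZMod (2 ^ 3), 2 * a = 0 → 4 * x = 0 → 2 * x ≠ 0 →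
    4 * y = 0 → gray 3 (a + w) = gray 3 (a + y) + gray 3 2 →
    gray 3 (a + x + w) ≠ gray 3 (a + x + y) + gray 3 2 := by
  decide +kernel

theorem gray_two_zero : gray 2 0 = 0 := by decide +kernel

theorem gray_three_zero : gray 3 0 = 0 := by decide +kernel

section
variable {A : GenMatrix} {c v w : ℕ → ℤ}

theorem dot_eq_of_grayMixed_eq (h : grayMixed (A.word w) = grayMixed (A.word c)
    + grayMixed (A.word v)) {z : Fin (A.k + 1) → ZMod 2} (hz : z ∈ A.A₁) :
    dot z w = dot z c + dot z v := by
  obtain ⟨j, rfl⟩ := List.mem_iff_get.1 hz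
  exact congrFun h (Sum.inl j)

theorem gray_two_eq_of_grayMixed_eq (h : grayMixed (A.word w) = grayMixed (A.word c)
    + grayMixed (A.word v)) {z : Fin (A.k + 1) → ZMod (2 ^ 2)} (hz : z ∈ A.A₂) :
    gray 2 (dot z w) = gray 2 (dot z c) + gray 2 (dot z v) := by
  obtain ⟨j, rfl⟩ := List.mem_iff_get.1 hz
  ext i
  exact congrFun h (Sum.inr (Sum.inl (j, i)))

theorem gray_three_eq_of_grayMixed_eq (h : grayMixed (A.word w) = grayMixed (A.word c)
    + grayMixed (A.word v)) {z : Fin (A.k + 1) → ZMod (2 ^ 3)} (hz : z ∈ A.A₃) :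
    gray 3 (dot z w) = gray 3 (dot z c) + gray 3 (dot z v) := by
  obtain ⟨j, rfl⟩ := List.mem_iff_get.1 hz
  ext i
  exact congrFun h (Sum.inr (Sum.inr (j, i)))

end

/-- The kernel of `H^{m,1,1}` consists of the Gray images of the words of order at most `2`. -/
theorem codeKernel_codeH_subset {m : ℕ} (hm : 2 ≤ m) :
    codeKernel (codeH m 1 1) ⊆
      grayMixed '' {u | u ∈ (genMatrix m 1 1).additiveCode ∧ (2 : ℕ) • u = 0} := by
  intro x hx
  have hx0 := hx 0 ⟨0, AddSubgroup.zero_mem _, grayMixed_zero⟩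
  rw [add_zero] at hx0
  obtain ⟨u, hu, rfl⟩ := hx0
  obtain ⟨c, rfl⟩ := mem_additiveCode.1 hu
  refine ⟨_, ⟨hu, ?_⟩, rfl⟩
  obtain ⟨hk, -, hr⟩ := genMatrix_properties (t₁ := m) (t₂ := 1) (l := 0) (by omega)
  obtain ⟨hA₁, hA₂, hA₃⟩ := genMatrix_one_one_columns (m := m) (by omega)
  change (genMatrix m 1 1).k = m + 1 at hk
  -- Adding a codeword `v` to an element of the kernel gives a codeword `w`, whose top coefficient
  -- is determined by the coordinates in `ℤ/2`.
  have key (v : ℕ → ℤ) (hv : v 0 = 0) : ∃ w : ℕ → ℤ, (2 : ℤ) ∣ w 0 - c 0 ∧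
      grayMixed ((genMatrix m 1 1).word w)
        = grayMixed ((genMatrix m 1 1).word c) + grayMixed ((genMatrix m 1 1).word v) := by
    obtain ⟨_, hw, hwv⟩ := hx _ ⟨_, mem_additiveCode.2 ⟨v, rfl⟩, rfl⟩
    obtain ⟨w, rfl⟩ := mem_additiveCode.1 hw
    refine ⟨w, ?_, hwv⟩
    have htop : ∀ d, dot (fun r : Fin ((genMatrix m 1 1).k + 1) =>
        (if (r : ℕ) = 0 then 1 else 0 : ZMod 2)) d = d 0 := fun d => by
      rw [dot, Fin.sum_univ_succ]
      simp
    have := dot_eq_of_grayMixed_eq hwv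
      (hA₁ (fun r => if r = 0 then 1 else 0) (if_pos rfl))
    rw [htop, htop, htop, hv, Int.cast_zero, add_zero, ← sub_eq_zero, ← Int.cast_sub,
      ZMod.intCast_zmod_eq_zero_iff_dvd] at this
    exact this
  -- An odd coefficient at `i` makes `χ ↦ χ(u) χ(v)` non-linear for `v` another row `j`; this shows
  -- in the coordinates `χ` of order `4` with support `{i}`, `{j}` and `{i, j}`.
  have heven : ∀ i, 1 ≤ i → i ≤ m + 1 → (2 : ℤ) ∣ c i := by
    intro i hi him
    by_contra hodd
    obtain ⟨j, hj, hjm, hij⟩ : ∃ j, 1 ≤ j ∧ j ≤ m + 1 ∧ i ≠ j := by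
      rcases eq_or_ne i 1 with rfl | h1
      · exact ⟨2, by omega, by omega, by omega⟩
      · exact ⟨1, le_rfl, by omega, h1⟩
    obtain ⟨w, hw0, hw⟩ := key (Pi.single j 1) (Pi.single_eq_of_ne (by omega) _)
    have hcol {a b : ℕ} (ha : 1 ≤ a) (hb : 1 ≤ b) (ham : a ≤ m + 1) :=
      gray_two_eq_of_grayMixed_eq hw (hA₂ _ (isNormalized_pairColumn (h := 2)
        (List.mem_cons_self ..) ha hb ham))
    have e1 := hcol hi hi him
    have e2 := hcol hj hj hjm
    have e3 := hcol hi hj him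
    have hvi : Pi.single (M := fun _ => ℤ) j 1 i = 0 := Pi.single_eq_of_ne hij _
    have hv0 : Pi.single (M := fun _ => ℤ) j 1 0 = 0 := Pi.single_eq_of_ne (by omega) _
    have htop : (w 0 : ZMod (2 ^ 2)) * 2 = c 0 * 2 := by
      obtain ⟨d, hd⟩ := hw0
      have h4 : (2 : ZMod (2 ^ 2)) * 2 = 0 := by decide
      rw [show w 0 = c 0 + 2 * d by omega]
      push_cast
      linear_combination (d : ZMod (2 ^ 2)) * h4
    simp only [dot_pairColumn (2 : ZMod (2 ^ 2)) hi hi (hk ▸ him) (hk ▸ him),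
      dot_pairColumn (2 : ZMod (2 ^ 2)) hj hj (hk ▸ hjm) (hk ▸ hjm),
      dot_pairColumn (2 : ZMod (2 ^ 2)) hi hj (hk ▸ him) (hk ▸ hjm), if_true, if_neg hij,
      add_zero, hvi, hv0, Pi.single_eq_same, Int.cast_zero, Int.cast_one, zero_mul, zero_add,
      gray_two_zero, htop] at e1 e2 e3
    have hwi := add_left_cancel (gray_two_injective e1)
    rw [hwi] at e3
    refine gray_two_not_additive _ _ _ _ ?_ (fun h2 => hodd ?_) e2 e3
    · have h4 : (2 : ZMod (2 ^ 2)) * 2 = 0 := by decide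
      linear_combination (c 0 : ZMod (2 ^ 2)) * h4
    · have h2' : ((2 * c i : ℤ) : ZMod (2 ^ 2)) = 0 := by push_cast; exact h2
      rw [ZMod.intCast_zmod_eq_zero_iff_dvd] at h2'
      push_cast at h2'
      omega
  -- All coefficients below the top being even, the same argument with `2 • v` and the coordinates
  -- of order `8` shows that those of the rows of order `8` are divisible by `4`.
  have hfour : ∀ i, 1 ≤ i → i ≤ m → (4 : ℤ) ∣ c i := by
    intro i hi him
    by_contra hodd
    obtain ⟨j, hj, hjm, hij⟩ : ∃ j, 1 ≤ j ∧ j ≤ m ∧ i ≠ j := by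
      rcases eq_or_ne i 1 with rfl | h1
      · exact ⟨2, by omega, by omega, by omega⟩
      · exact ⟨1, le_rfl, by omega, h1⟩
    obtain ⟨w, hw0, hw⟩ := key (Pi.single j 2) (Pi.single_eq_of_ne (by omega) _)
    have hcol {a b : ℕ} (ha : 1 ≤ a) (hb : 1 ≤ b) (ham : a ≤ m) (hbm : b ≤ m) :=
      gray_three_eq_of_grayMixed_eq hw (hA₃ _ (isNormalized_pairColumn (h := 4)
        (List.mem_cons_self ..) ha hb ham)
        (by rw [pairColumn, if_neg (by omega), if_neg (by omega)]))
    have e1 := hcol hi hi him him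
    have e2 := hcol hj hj hjm hjm
    have e3 := hcol hi hj him hjm
    have him' : i ≤ (genMatrix m 1 1).k := by omega
    have hjm' : j ≤ (genMatrix m 1 1).k := by omega
    have hvi : Pi.single (M := fun _ => ℤ) j 2 i = 0 := Pi.single_eq_of_ne hij _
    have hv0 : Pi.single (M := fun _ => ℤ) j 2 0 = 0 := Pi.single_eq_of_ne (by omega) _
    have h8 : (2 : ZMod (2 ^ 3)) * 4 = 0 := by decide
    have htop : (w 0 : ZMod (2 ^ 3)) * 4 = c 0 * 4 := by
      obtain ⟨d, hd⟩ := hw0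
      rw [show w 0 = c 0 + 2 * d by omega]
      push_cast
      linear_combination (d : ZMod (2 ^ 3)) * h8
    have hcast {a : ℕ} (ha : 1 ≤ a) (ham : a ≤ m) : 4 * (c a : ZMod (2 ^ 3)) = 0 := by
      obtain ⟨d, hd⟩ := heven a ha (by omega)
      rw [hd]
      push_cast
      linear_combination (d : ZMod (2 ^ 3)) * h8
    simp only [dot_pairColumn (4 : ZMod (2 ^ 3)) hi hi him' him',
      dot_pairColumn (4 : ZMod (2 ^ 3)) hj hj hjm' hjm',
      dot_pairColumn (4 : ZMod (2 ^ 3)) hi hj him' hjm', if_true, if_neg hij,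
      add_zero, hvi, hv0, Pi.single_eq_same, Int.cast_zero, Int.cast_ofNat, zero_mul, zero_add,
      gray_three_zero, htop] at e1 e2 e3
    have hwi := add_left_cancel (gray_three_injective e1)
    rw [hwi] at e3
    refine gray_three_not_additive _ _ _ _ ?_ (hcast hi him) (fun h2 => hodd ?_) (hcast hj hjm)
      e2 e3
    · linear_combination (c 0 : ZMod (2 ^ 3)) * h8
    · have h2' : ((2 * c i : ℤ) : ZMod (2 ^ 3)) = 0 := by push_cast; exact h2
      rw [ZMod.intCast_zmod_eq_zero_iff_dvd] at h2'
      push_cast at h2'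
      omega
  rw [two_nsmul, ← word_add]
  refine hr.word_eq_zero fun r hrk => ?_
  change r < (genMatrix m 1 1).k + 1 at hrk
  rw [Pi.add_apply]
  rcases r with _ | r
  · simp only [rowOrder]
    push_cast
    omega
  · simp only [rowOrder]
    split_ifs with h1 h2
    · have := hfour (r + 1) (by omega) (by omega)
      push_cast
      omega
    · have := heven (r + 1) (by omega) (by omega)
      push_cast
      omega
    · omega

theorem ncard_codeKernel_codeH_le {m : ℕ} (hm : 2 ≤ m) :
    (codeKernel (codeH m 1 1)).ncard ≤ 2 ^ (m + 2) := by
  refine (Set.ncard_le_ncard (codeKernel_codeH_subset hm) (Set.toFinite _)).trans ?_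
  rw [Set.ncard_image_of_injective _ grayMixed_injective]
  exact two_torsion_genMatrix_le (by omega) le_rfl

/-- A code that is the injective image of a group of exponent `4` under a map that is additive on
`2`-torsion has a kernel of at least the square root of its size, hence it is not equivalent to
`H^{m,1,1}`. -/
theorem not_equivalent_of_exponent_four {m : ℕ} (hm : 2 ≤ m) {G ι : Type*} [AddCommGroup G]
    [Finite G] [Finite ι] (h4 : ∀ u : G, (4 : ℕ) • u = 0) {Φ : G → ι → ZMod 2}
    (hinj : Function.Injective Φ) (hadd : ∀ u v, (2 : ℕ) • u = 0 → Φ (u + v) = Φ u + Φ v)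
    (C : AddSubgroup G) : ¬ Equivalent (codeH m 1 1) (Φ '' (C : Set G)) := by
  intro h
  have h1 := h.ncard_eq
  rw [Set.ncard_image_of_injective _ hinj, codeH,
    Set.ncard_image_of_injective _ grayMixed_injective,
    ncard_additiveCode_genMatrix (by omega) le_rfl] at h1
  have h2 := h.ncard_codeKernel_eq.trans_le (ncard_codeKernel_codeH_le hm)
  have h3 := (ncard_two_torsion_le_ncard_codeKernel hinj hadd C).trans h2
  have h5 := (ncard_le_sq_two_torsion C h4).trans (Nat.pow_le_pow_left h3 2)
  rw [h1, ← pow_mul] at h5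
  have := (Nat.pow_le_pow_iff_right (le_refl 2)).1 h5
  omega

theorem four_nsmul_zmod_two : ∀ x : ZMod 2, (4 : ℕ) • x = 0 := by decide

theorem four_nsmul_zmod_four : ∀ x : ZMod (2 ^ 2), (4 : ℕ) • x = 0 := by decide

theorem not_equivalent_codeH {m t₁ t₂ t₃ : ℕ} (hm : 2 ≤ m) (ht₁ : 1 ≤ t₁) (ht₃ : 1 ≤ t₃)
    (hne : (t₁, t₂, t₃) ≠ (m, 1, 1)) : ¬ Equivalent (codeH m 1 1) (codeH t₁ t₂ t₃) := by
  intro h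
  have h1 := h.ncard_eq
  rw [codeH, codeH, Set.ncard_image_of_injective _ grayMixed_injective,
    Set.ncard_image_of_injective _ grayMixed_injective,
    ncard_additiveCode_genMatrix ht₁ ht₃, ncard_additiveCode_genMatrix (by omega) le_rfl] at h1
  have h2 := h.ncard_codeKernel_eq.trans_le (ncard_codeKernel_codeH_le hm)
  have h3 := ((two_torsion_genMatrix_ge (t₂ := t₂) ht₁ ht₃).trans
    (ncard_two_torsion_le_ncard_codeKernel grayMixed_injective grayMixed_add _)).trans h2
  have h4 := (Nat.pow_le_pow_iff_right (le_refl 2)).1 h3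
  have h5 := Nat.pow_right_injective (le_refl 2) h1
  refine hne ?_
  obtain rfl : t₃ = 1 := by omega
  obtain rfl : t₁ = m := by omega
  obtain rfl : t₂ = 1 := by omega
  rfl

end HadamardCodes

theorem mainTheorem7 (m t : ℕ) (hm : 2 ≤ m) (ht : t = 3 * m + 2) :
    -- `H^{m,1,1}` is a Hadamard code of length `2 ^ t`
    ((HadamardCodes.genMatrix m 1 1).length = 2 ^ t ∧
      HadamardCodes.IsHadamard (HadamardCodes.codeH m 1 1)) ∧
    -- it is not equivalent to any other `H^{t₁,t₂,t₃}` of the same length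
    (∀ t₁ t₂ t₃ : ℕ, 1 ≤ t₁ → 1 ≤ t₃ → (t₁, t₂, t₃) ≠ (m, 1, 1) →
      (HadamardCodes.genMatrix t₁ t₂ t₃).length = 2 ^ t →
      ¬ HadamardCodes.Equivalent (HadamardCodes.codeH m 1 1) (HadamardCodes.codeH t₁ t₂ t₃)) ∧
    -- nor to any `ℤ₄`-linear Hadamard code of the same length
    (∀ (n : ℕ) (C : AddSubgroup (Fin n → ZMod (2 ^ 2))), 2 * n = 2 ^ t →
      HadamardCodes.IsHadamard (HadamardCodes.grayExt 2 '' (C : Set (Fin n → ZMod (2 ^ 2)))) →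
      ¬ HadamardCodes.Equivalent (HadamardCodes.codeH m 1 1)
        (HadamardCodes.grayExt 2 '' (C : Set (Fin n → ZMod (2 ^ 2))))) ∧
    -- nor to any `ℤ₂ℤ₄`-linear Hadamard code of the same length
    (∀ (α₁ α₂ : ℕ) (C : AddSubgroup (HadamardCodes.Mixed α₁ α₂ 0)), α₁ + 2 * α₂ = 2 ^ t →
      HadamardCodes.IsHadamard
        (HadamardCodes.grayMixed '' (C : Set (HadamardCodes.Mixed α₁ α₂ 0))) →
      ¬ HadamardCodes.Equivalent (HadamardCodes.codeH m 1 1)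
        (HadamardCodes.grayMixed '' (C : Set (HadamardCodes.Mixed α₁ α₂ 0)))) := by
  subst ht
  refine ⟨⟨?_, HadamardCodes.isHadamard_codeH (by omega) le_rfl⟩, ?_, ?_, ?_⟩
  · rw [HadamardCodes.length_genMatrix (by omega) le_rfl]
    congr 1
  · intro t₁ t₂ t₃ ht₁ ht₃ hne _
    exact HadamardCodes.not_equivalent_codeH hm ht₁ ht₃ hne
  · intro n C _ _
    refine HadamardCodes.not_equivalent_of_exponent_four hm (fun u => ?_)
      HadamardCodes.grayExt_two_injective HadamardCodes.grayExt_two_add C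
    ext j
    exact HadamardCodes.four_nsmul_zmod_four (u j)
  · intro α₁ α₂ C _ _
    refine HadamardCodes.not_equivalent_of_exponent_four hm (fun u => ?_)
      HadamardCodes.grayMixed_injective HadamardCodes.grayMixed_add C
    refine Prod.ext ?_ (Prod.ext ?_ (Subsingleton.elim _ _))
    · ext j
      exact HadamardCodes.four_nsmul_zmod_two (u.1 j)
    · ext j
      exact HadamardCodes.four_nsmul_zmod_four (u.2.1 j)
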